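/- Let $(X,d)$ be a metric space of diameter $\sup_{x,y\in X} d(x,y)=2$ (attained or not) that is geodesic, i.e. any two points $a,b$ are the endpoints of an isometric copy of the segment $[0,d(a,b)]$ in $X$, and let $O\in X$ be any origin. A request is a triple $f=(A,[r,r+2],\delta)$ with location $A\in X$, release time $r\ge 0$ and weight $\delta>0$. For $n\ge 1$ and $T\ge 0$, $\mathcal I_{n,T}$ is the set of instances consisting of at least one and at most $n$ requests whose release times pairwise differ by at least $T$. A vehicle starts at $O$ at time $0$ and moves in $X$ at speed at most $1$; it serves $f$ if it is at $A$ at some time $t\in[r,r+2]$. An online algorithm $ALG$ assigns to each finite set of requests an itinerary of the vehicle whose position at time $t$ depends only on the requests released up to time $t$. The performance $\lambda^I$ of an itinerary on an instance $I$ is the total weight of the requests served divided by the total weight of all requests of $I$; $\lambda^I_{ALG}$ is the performance on $I$ of the itinerary that $ALG$ follows on $I$, and $\lambda^I_{OPT}$ is the supremum of the performances on $I$ of all itineraries. Put $$\lambda^{\mathcal I_{n,T}}=\sup_{ALG}\ \inf_{I\in\mathcal I_{n,T}}\lambda^I_{ALG},\qquad \gamma_{ALG}^{\mathcal I_{n,T}}=\inf_{I\in\mathcal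 I_{n,T}}\frac{\lambda^I_{ALG}}{\lambda^I_{OPT}},\qquad \gamma^{\mathcal I_{n,T}}=\sup_{ALG}\gamma_{ALG}^{\mathcal I_{n,T}},$$ and call $ALG$ optimal for $\mathcal I_{n,T}$ if $\gamma_{ALG}^{\mathcal I_{n,T}}=\gamma^{\mathcal I_{n,T}}$. A greedy algorithm $GR_0$ is an online algorithm that, whenever some released request is neither served nor expired, moves at unit speed along a shortest path towards such a request of greatest weight, keeping its destination until that request is served or expires or a strictly heavier request is pending (ties, the choice of shortest paths and the behaviour while no request is pending are arbitrary). Theorem. A greedy algorithm $GR_0$ exists, and for every integer $n\ge 1$: (1) (zero delay) every greedy algorithm $GR_0$ is optimal for $\mathcal I_{n,0}$, and $\gamma^{\mathcal I_{n,0}}=\frac1n$; (2) (small delay, performance) if $0\le T<\frac{1}{2^{n-3}+1}$, then $\lambda^{\mathcal I_{n,T}}=\frac1n$; (3) (small delay, competitive ratio) if $n\ge 3$ and $0\le T<\frac{1}{2^{n-1}-2}$, then every greedy algorithm $GR_0$ is optimal for $\mathcal I_{n,T}$, and $\gamma^{\mathcal I_{n,T}}=\frac1n$. -/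

import Mathlib

namespace OPTiWinD

/-- A metric space is geodesic if any two points `a`, `b` are the endpoints of an isometric copy
of the segment `[0, d(a,b)]`. -/
def IsGeodesicSpace (X : Type*) [MetricSpace X] : Prop :=
  ∀ a b : X, ∃ γ : ℝ → X, γ 0 = a ∧ γ (dist a b) = b ∧
    ∀ s ∈ Set.Icc (0 : ℝ) (dist a b), ∀ t ∈ Set.Icc (0 : ℝ) (dist a b),
      dist (γ s) (γ t) = |s - t|

/-- A request: a location, a release time `r ≥ 0` and a weight `> 0`.  Its time window is
`[r, r + 2]`. -/
@[ext]
structure Request (X : Type*) where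
  loc : X
  release : ℝ
  weight : ℝ
  release_nonneg : 0 ≤ release
  weight_pos : 0 < weight

/-- The time at which an unserved request is lost. -/
def Request.deadline {X : Type*} (f : Request X) : ℝ := f.release + 2

/-- The instances with at least one and at most `n` requests whose release times pairwise differ
by at least `T`. -/
def instances (X : Type*) (n : ℕ) (T : ℝ) : Set (Finset (Request X)) :=
  {I | I.Nonempty ∧ I.card ≤ n ∧
    ∀ f ∈ I, ∀ g ∈ I, f ≠ g → T ≤ |f.release - g.release|}

/-- An itinerary of the vehicle: it is at `O` at time `0` and moves no faster than unit speed.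
Only the positions at times `t ≥ 0` matter. -/
structure Itinerary {X : Type*} [MetricSpace X] (O : X) where
  pos : ℝ → X
  start : pos 0 = O
  speed : ∀ s t : ℝ, 0 ≤ s → s ≤ t → dist (pos s) (pos t) ≤ t - s

section

variable {X : Type*} [MetricSpace X] {O : X}

/-- A request is served if the vehicle is at its location at some time of its window. -/
def Itinerary.Serves (x : Itinerary O) (f : Request X) : Prop :=
  ∃ t ∈ Set.Icc f.release f.deadline, x.pos t = f.loc

open scoped Classical in
/-- The performance on `I`: the total weight of the served requests over the total weight. -/
noncomputable def Itinerary.performance (x : Itinerary O) (I : Finset (Request X)) : ℝ :=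
  (∑ f ∈ I with x.Serves f, f.weight) / ∑ f ∈ I, f.weight

/-- The performance of an optimal offline algorithm on `I` (all performances are in `[0,1]`). -/
noncomputable def offlinePerformance (O : X) (I : Finset (Request X)) : ℝ :=
  ⨆ x : Itinerary O, x.performance I

end

/-- A (deterministic) online algorithm: it assigns an itinerary to every finite set of requests,
and the position at time `t` depends only on the requests released up to time `t`. -/
structure OnlineAlgorithm {X : Type*} [MetricSpace X] (O : X) where
  run : Finset (Request X) → Itinerary O
  causal : ∀ (I J : Finset (Request X)) (t : ℝ), 0 ≤ t →
    (∀ f : Request X, f.release ≤ t → (f ∈ I ↔ f ∈ J)) → (run I).pos t = (run J).pos t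

section

variable {X : Type*} [MetricSpace X] {O : X}

/-- The performance of an online algorithm for at most `n` requests and delay `T`. -/
noncomputable def OnlineAlgorithm.performance (A : OnlineAlgorithm O) (n : ℕ) (T : ℝ) : ℝ :=
  ⨅ I : instances X n T, (A.run I.1).performance I.1

/-- The competitive ratio of an online algorithm for at most `n` requests and delay `T`. -/
noncomputable def OnlineAlgorithm.competitiveRatio (A : OnlineAlgorithm O) (n : ℕ) (T : ℝ) : ℝ :=
  ⨅ I : instances X n T, (A.run I.1).performance I.1 / offlinePerformance O I.1

/-- The optimal performance for at most `n` requests and delay `T`. -/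
noncomputable def optimalPerformance (O : X) (n : ℕ) (T : ℝ) : ℝ :=
  ⨆ A : OnlineAlgorithm O, A.performance n T

/-- The optimal competitive ratio for at most `n` requests and delay `T`. -/
noncomputable def optimalCompetitiveRatio (O : X) (n : ℕ) (T : ℝ) : ℝ :=
  ⨆ A : OnlineAlgorithm O, A.competitiveRatio n T

/-- An online algorithm is optimal if its competitive ratio is the optimal one. -/
def OnlineAlgorithm.IsOptimal (A : OnlineAlgorithm O) (n : ℕ) (T : ℝ) : Prop :=
  A.competitiveRatio n T = optimalCompetitiveRatio O n T

/-- The request `f` of `I` is pending at time `t`: it has been released, it is not lost, and it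
has not been served up to time `t` (inclusive). -/
def Itinerary.Pending (x : Itinerary O) (I : Finset (Request X)) (f : Request X) (t : ℝ) : Prop :=
  f ∈ I ∧ t ∈ Set.Icc f.release f.deadline ∧ ∀ s ∈ Set.Icc f.release t, x.pos s ≠ f.loc

/-- The request `f` is pending at time `t` and no pending request has a greater weight. -/
def Itinerary.IsHeaviest (x : Itinerary O) (I : Finset (Request X)) (f : Request X) (t : ℝ) :
    Prop :=
  x.Pending I f t ∧ ∀ g, x.Pending I g t → g.weight ≤ f.weight

/-- `x` is an itinerary of the greedy rule on `I`.  At every time at which some request is pending,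
the vehicle has as its destination a pending request of greatest weight; it keeps this destination
as long as it is pending and no heavier request is; and it moves towards its destination at unit
speed along a shortest path.  Nothing is prescribed while no request is pending. -/
def Itinerary.IsGreedy (x : Itinerary O) (I : Finset (Request X)) : Prop :=
  ∃ dest : ℝ → Option (Request X),
    (∀ t, 0 ≤ t → ∀ f, dest t = some f → x.IsHeaviest I f t) ∧
    (∀ t, 0 ≤ t → ∀ f, x.Pending I f t → ∃ g, dest t = some g) ∧
    (∀ s t, 0 ≤ s → s ≤ t → ∀ f, dest s = some f →
      (∀ u ∈ Set.Icc s t, x.IsHeaviest I f u) → dest t = some f) ∧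
    (∀ s t, 0 ≤ s → s ≤ t → ∀ f, (∀ u ∈ Set.Icc s t, dest u = some f) →
      dist (x.pos t) f.loc = dist (x.pos s) f.loc - (t - s))

/-- `A` is the greedy algorithm `GR₀` (for some choice of shortest paths, some way of breaking
ties and some behaviour while no request is pending). -/
def OnlineAlgorithm.IsGreedy (A : OnlineAlgorithm O) : Prop :=
  ∀ I : Finset (Request X), (A.run I).IsGreedy I

end

end OPTiWinD

/-! Lower bound: an earliest request among the heaviest ones (up to a tie in release time) becomes
the greedy destination when it is released, and is never displaced. The diameter is 2, so it is
reached within its window. Hence greedy collects at least `1 / n` of the weight, and offline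
performance is at most 1 (`Itinerary.IsGreedy.exists_serves`).

Upper bound: an adversary plays unit requests at two points at distance `L` close to 2. When the
vehicle has come within a margin `e` of a pending request `a`, a request `b` appears at the other
point. The vehicle cannot serve both, so before it gets near either of them one becomes lost. If `b`
is lost, it is renewed at the same point. If `a` is lost, the adversary waits until the vehicle is
within the next margin of `b` and places a request at the location of `a`, with roles exchanged.
Always at most two requests are alive (`Pursuit`, `exists_next`), and at the end of the game at most
one of `n` requests is served (`serves_unique`). A vehicle that never approaches serves nothing.

Thresholds: let `e k` be the margin with `k` requests still to come. The wait before the next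
request must be at least `T` and at least `e k`, while the vehicle must stay `e k` away from `a`; so
`e (k + 1)` is about `e k + max T (e k)`, that is `e 0 ≈ 0` and `e (k + 1) ≈ 2 ^ k * T`. The first
two releases are about `1 - e (n - 2)` apart, which must be at least `T`: this gives `(2 ^ (n - 3) +
1) * T < 1`. For the competitive ratio an offline vehicle must serve everything. It stays ahead of
the online one by a lead that loses at most `2 * e k` per move, and the sum of these losses gives
`(2 ^ (n - 1) - 2) * T < 1`. The small `σ` absorbs all approximations. -/

namespace OPTiWinD

/-! ### Priorities and truncated instances -/

section

variable {X : Type*}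

/-- Heavier requests come first, then earlier ones; remaining ties are broken by a fixed order. -/
noncomputable def priority (f : Request X) : ℝ ×ₗ ℝ ×ₗ Cardinal :=
  toLex (f.weight, toLex (-f.release, embeddingToCardinal f))

theorem priority_injective : Function.Injective (priority : Request X → _) := by
  intro f g h
  have h1 := congrArg (fun p => (ofLex (ofLex p).2).2) h
  exact embeddingToCardinal.injective h1

theorem weight_le_of_priority_le {f g : Request X} (h : priority f ≤ priority g) :
    f.weight ≤ g.weight := by
  rcases (Prod.Lex.le_iff).1 h with h | h
  · exact le_of_lt h
  · exact le_of_eq h.1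

theorem priority_le_of_release_lt {f g : Request X} (hw : f.weight ≤ g.weight)
    (hr : g.release < f.release) : priority f ≤ priority g := by
  rcases hw.lt_or_eq with hw | hw
  · exact (Prod.Lex.le_iff).2 (Or.inl hw)
  · refine (Prod.Lex.le_iff).2 (Or.inr ⟨hw, (Prod.Lex.le_iff).2 (Or.inl ?_)⟩)
    exact neg_lt_neg hr

/-- The last release time of a nonempty instance. -/
noncomputable def lastRelease (J : Finset (Request X)) (h : J.Nonempty) : ℝ :=
  J.sup' h Request.release

theorem release_le_lastRelease {J : Finset (Request X)} (h : J.Nonempty) :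
    ∀ f ∈ J, f.release ≤ lastRelease J h := fun _ hf => Finset.le_sup' Request.release hf

theorem lastRelease_nonneg {J : Finset (Request X)} (h : J.Nonempty) : 0 ≤ lastRelease J h := by
  obtain ⟨f, hf⟩ := h
  exact f.release_nonneg.trans (release_le_lastRelease _ f hf)

open scoped Classical in
/-- The requests of `J` released before time `r`. -/
noncomputable def releasedBefore (J : Finset (Request X)) (r : ℝ) : Finset (Request X) :=
  J.filter fun f => f.release < r

theorem mem_releasedBefore {J : Finset (Request X)} {r : ℝ} {f : Request X} :
    f ∈ releasedBefore J r ↔ f ∈ J ∧ f.release < r := by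
  simp [releasedBefore]

theorem card_releasedBefore_lt {J : Finset (Request X)} (h : J.Nonempty) :
    (releasedBefore J (lastRelease J h)).card < J.card := by
  classical
  obtain ⟨f, hf, hr⟩ := Finset.exists_mem_eq_sup' h Request.release
  refine Finset.card_lt_card (Finset.ssubset_iff_subset_ne.2
    ⟨fun g hg => (mem_releasedBefore.1 hg).1, fun he => ?_⟩)
  rw [← he] at hf
  exact (mem_releasedBefore.1 hf).2.ne hr.symm

end

section

variable {X : Type*} [MetricSpace X] {O : X}

/-! ### Itineraries -/

theorem Itinerary.dist_le (x : Itinerary O) {s t : ℝ} (hs : 0 ≤ s) (ht : 0 ≤ t) :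
    dist (x.pos s) (x.pos t) ≤ |s - t| := by
  rcases le_total s t with h | h
  · rw [abs_sub_comm, abs_of_nonneg (sub_nonneg.2 h)]
    exact x.speed s t hs h
  · rw [abs_of_nonneg (sub_nonneg.2 h), dist_comm]
    exact x.speed t s ht h

theorem Itinerary.dist_sub_le (x : Itinerary O) {s t : ℝ} (hs : 0 ≤ s) (hst : s ≤ t) (P : X) :
    dist (x.pos s) P - (t - s) ≤ dist (x.pos t) P := by
  have := x.speed s t hs hst
  have := dist_triangle (x.pos s) (x.pos t) P
  linarith

theorem Itinerary.continuousOn_dist (x : Itinerary O) (P : X) :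
    ContinuousOn (fun s => dist (x.pos s) P) (Set.Ici 0) := by
  have : ContinuousOn x.pos (Set.Ici 0) := by
    refine LipschitzOnWith.continuousOn (K := 1) (LipschitzOnWith.of_dist_le_mul ?_)
    intro s hs t ht
    simpa [Real.dist_eq] using x.dist_le hs ht
  exact continuous_dist.comp_continuousOn (this.prodMk continuousOn_const)

/-- Two itineraries coincide up to time `t`. -/
def Itinerary.AgreesUntil (x y : Itinerary O) (t : ℝ) : Prop :=
  ∀ s, 0 ≤ s → s ≤ t → x.pos s = y.pos s

theorem Itinerary.AgreesUntil.trans {x y z : Itinerary O} {s t : ℝ} (h : x.AgreesUntil y t)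
    (h' : y.AgreesUntil z s) (hst : s ≤ t) : x.AgreesUntil z s :=
  fun u hu hus => (h u hu (hus.trans hst)).trans (h' u hu hus)

/-- An itinerary may be changed from time `r` on: the vehicle moves towards `P` for a time `d` and
then stops. -/
theorem Itinerary.exists_extension (hgeo : IsGeodesicSpace X) (x : Itinerary O) {r d : ℝ}
    (hr : 0 ≤ r) (hd : 0 ≤ d) (P : X) (hdP : d ≤ dist (x.pos r) P) :
    ∃ y : Itinerary O, y.AgreesUntil x r ∧
      (∀ s ∈ Set.Icc r (r + d), dist (y.pos s) P = dist (x.pos r) P - (s - r)) ∧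
      ∀ s, r + d ≤ s → y.pos s = y.pos (r + d) := by
  obtain ⟨γ, h0, h1, hγ⟩ := hgeo (x.pos r) P
  set D := dist (x.pos r) P
  have hmem : ∀ s, r ≤ s → min (s - r) d ∈ Set.Icc 0 D := fun s hs =>
    ⟨le_min (sub_nonneg.2 hs) hd, (min_le_right _ _).trans hdP⟩
  have hlip : ∀ s t, r ≤ s → s ≤ t → dist (γ (min (s - r) d)) (γ (min (t - r) d)) ≤ t - s := by
    intro s t hs hst
    rw [hγ _ (hmem s hs) _ (hmem t (hs.trans hst))]
    refine (abs_min_sub_min_le_max _ _ _ _).trans ?_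
    rw [abs_sub_comm]
    simp [abs_of_nonneg (sub_nonneg.2 hst), hst]
  have hr' : γ (min (r - r) d) = x.pos r := by simp [hd, h0]
  let p : ℝ → X := fun s => if s ≤ r then x.pos s else γ (min (s - r) d)
  have hp : ∀ s, r ≤ s → p s = γ (min (s - r) d) := by
    intro s hs
    rcases hs.eq_or_lt with rfl | hs
    · simp only [p, le_refl, if_true, hr']
    · simp only [p, not_le.2 hs, if_false]
  have hp' : ∀ s, s ≤ r → p s = x.pos s := fun s hs => if_pos hs
  refine ⟨⟨p, by rw [hp' 0 hr, x.start], ?_⟩, fun s _ hs => hp' s hs, ?_, ?_⟩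
  · intro s t hs hst
    rcases le_total t r with ht | ht
    · rw [hp' _ ht, hp' _ (hst.trans ht)]
      exact x.speed s t hs hst
    · rcases le_total s r with hs' | hs'
      · have h2 := hlip r t le_rfl ht
        rw [hr'] at h2
        rw [hp' s hs', hp t ht]
        have := x.speed s r hs hs'
        have := dist_triangle (x.pos s) (x.pos r) (γ (min (t - r) d))
        linarith
      · rw [hp s hs', hp t ht]
        exact hlip s t hs' hst
  · intro s hs
    change dist (p s) P = _
    have h2 : min (s - r) d = s - r := min_eq_left (by linarith [hs.2])
    have h3 := hmem s hs.1
    rw [hp s hs.1, h2]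
    rw [h2] at h3
    rw [← h1, hγ _ h3 _ ⟨dist_nonneg, le_rfl⟩, abs_sub_comm, abs_of_nonneg (sub_nonneg.2 h3.2)]
  · intro s hs
    change p s = p (r + d)
    rw [hp s (by linarith), hp (r + d) (by linarith)]
    congr 1
    simp [min_eq_right (show d ≤ s - r by linarith)]

/-- The itinerary that stays at the origin. -/
def Itinerary.stay (O : X) : Itinerary O where
  pos _ := O
  start := rfl
  speed s t _ h := by simpa using h

/-! ### Existence of greedy algorithms -/

/-- `f` is the pending request of greatest priority. -/
def Itinerary.IsBest (x : Itinerary O) (J : Finset (Request X)) (f : Request X) (t : ℝ) : Prop :=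
  x.Pending J f t ∧ ∀ g, x.Pending J g t → priority g ≤ priority f

theorem Itinerary.IsBest.unique {x : Itinerary O} {J : Finset (Request X)} {f g : Request X}
    {t : ℝ} (hf : x.IsBest J f t) (hg : x.IsBest J g t) : f = g :=
  priority_injective (le_antisymm (hg.2 f hf.1) (hf.2 g hg.1))

theorem Itinerary.IsBest.isHeaviest {x : Itinerary O} {J : Finset (Request X)} {f : Request X}
    {t : ℝ} (hf : x.IsBest J f t) : x.IsHeaviest J f t :=
  ⟨hf.1, fun g hg => weight_le_of_priority_le (hf.2 g hg)⟩

theorem Itinerary.Pending.exists_isBest {x : Itinerary O} {J : Finset (Request X)} {f : Request X}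
    {t : ℝ} (hf : x.Pending J f t) : ∃ g, x.IsBest J g t := by
  classical
  obtain ⟨g, hg, hmax⟩ := (J.filter (fun g => x.Pending J g t)).exists_max_image priority
    ⟨f, Finset.mem_filter.2 ⟨hf.1, hf⟩⟩
  exact ⟨g, (Finset.mem_filter.1 hg).2, fun h hh => hmax h (Finset.mem_filter.2 ⟨hh.1, hh⟩)⟩

theorem Itinerary.Pending.congr {x y : Itinerary O} {I J : Finset (Request X)} {f : Request X}
    {t : ℝ} (hxy : x.AgreesUntil y t) (hIJ : f ∈ I → f.release ≤ t → f ∈ J)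
    (hf : x.Pending I f t) : y.Pending J f t :=
  ⟨hIJ hf.1 hf.2.1.1, hf.2.1, fun s hs => by
    rw [← hxy s (f.release_nonneg.trans hs.1) hs.2]; exact hf.2.2 s hs⟩

theorem Itinerary.AgreesUntil.symm {x y : Itinerary O} {t : ℝ} (h : x.AgreesUntil y t) :
    y.AgreesUntil x t := fun s hs hst => (h s hs hst).symm

theorem Itinerary.AgreesUntil.mono {x y : Itinerary O} {s t : ℝ} (h : x.AgreesUntil y t)
    (hst : s ≤ t) : x.AgreesUntil y s := fun u hu hus => h u hu (hus.trans hst)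

theorem Itinerary.IsBest.congr {x y : Itinerary O} {I J : Finset (Request X)} {f : Request X}
    {t : ℝ} (hxy : x.AgreesUntil y t) (hIJ : ∀ f : Request X, f.release ≤ t → (f ∈ I ↔ f ∈ J))
    (hf : x.IsBest I f t) : y.IsBest J f t :=
  ⟨hf.1.congr hxy fun h h' => (hIJ f h').1 h,
    fun g hg => hf.2 g (hg.congr hxy.symm fun h h' => (hIJ g h').2 h)⟩

/-- From time `r` on, the vehicle moves straight to the pending request of greatest priority. -/
def Itinerary.Straight (x : Itinerary O) (J : Finset (Request X)) (r : ℝ) : Prop :=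
  ∀ s t f, r ≤ s → s ≤ t → (∀ u ∈ Set.Ico s t, x.IsBest J f u) →
    dist (x.pos t) f.loc = dist (x.pos s) f.loc - (t - s)

/-- The destination is the best pending request. It is never dropped for another one of equal
weight, because ties in weight favour the earlier release. -/
theorem Itinerary.Straight.isGreedy {x : Itinerary O} {J : Finset (Request X)}
    (h : x.Straight J 0) : x.IsGreedy J := by
  classical
  let dest : ℝ → Option (Request X) := fun t =>
    if h : ∃ f, x.IsBest J f t then some h.choose else none
  have hdest : ∀ t f, dest t = some f ↔ x.IsBest J f t := by
    intro t f
    by_cases he : ∃ f, x.IsBest J f t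
    · simp only [dest, he, dif_pos, Option.some.injEq]
      exact ⟨fun h => h ▸ he.choose_spec, fun h => he.choose_spec.unique h⟩
    · simp only [dest, he, dif_neg, not_false_eq_true, reduceCtorEq, false_iff]
      exact fun h => he ⟨f, h⟩
  refine ⟨dest, fun t _ f hf => ((hdest t f).1 hf).isHeaviest, fun t _ f hf => ?_, ?_, ?_⟩
  · obtain ⟨g, hg⟩ := hf.exists_isBest
    exact ⟨g, (hdest t g).2 hg⟩
  · intro s t _ hst f hf hheavy
    have hs := (hdest s f).1 hf
    refine (hdest t f).2 ⟨(hheavy t ⟨hst, le_rfl⟩).1, fun g hg => ?_⟩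
    rcases le_or_gt g.release s with hgs | hgs
    · exact hs.2 g ⟨hg.1, ⟨hgs, hst.trans hg.2.1.2⟩,
        fun u hu => hg.2.2 u ⟨hu.1, hu.2.trans hst⟩⟩
    · exact priority_le_of_release_lt ((hheavy t ⟨hst, le_rfl⟩).2 g hg)
        (hs.1.2.1.1.trans_lt hgs)
  · intro s t hs hst f hf
    exact h s t f hs hst fun u hu => (hdest u f).1 (hf u ⟨hu.1, hu.2.le⟩)

/-- If a straight itinerary and a straight continuation are glued, the result is straight. -/
theorem Itinerary.Straight.concat {x : Itinerary O} {J : Finset (Request X)} {r r' : ℝ}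
    (h : ∀ s t f, r ≤ s → s ≤ t → t ≤ r' → (∀ u ∈ Set.Ico s t, x.IsBest J f u) →
      dist (x.pos t) f.loc = dist (x.pos s) f.loc - (t - s))
    (h' : x.Straight J r') : x.Straight J r := by
  intro s t f hs hst hf
  rcases le_total t r' with ht | ht
  · exact h s t f hs hst ht hf
  rcases le_total r' s with hs' | hs'
  · exact h' s t f hs' hst hf
  rw [h' r' t f le_rfl ht fun u hu => hf u ⟨hs'.trans hu.1, hu.2⟩,
    h s r' f hs hs' le_rfl fun u hu => hf u ⟨hu.1, hu.2.trans_le ht⟩]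
  ring

open scoped Classical in
/-- The requests of `J` that can still be pending after time `r`. -/
noncomputable def Itinerary.alive (x : Itinerary O) (J : Finset (Request X)) (r : ℝ) :
    Finset (Request X) :=
  J.filter fun f => r < f.deadline ∧ ∀ s ∈ Set.Icc f.release r, x.pos s ≠ f.loc

theorem Itinerary.mem_alive {x : Itinerary O} {J : Finset (Request X)} {r : ℝ} {f : Request X} :
    f ∈ x.alive J r ↔
      f ∈ J ∧ r < f.deadline ∧ ∀ s ∈ Set.Icc f.release r, x.pos s ≠ f.loc := by
  simp [Itinerary.alive]

theorem Itinerary.mem_alive_of_pending {x y : Itinerary O} {J : Finset (Request X)} {r t : ℝ}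
    {f : Request X} (hxy : x.AgreesUntil y r) (hrt : r < t) (hf : y.Pending J f t) :
    f ∈ x.alive J r :=
  mem_alive.2 ⟨hf.1, hrt.trans_le hf.2.1.2, fun s hs => by
    rw [hxy s (f.release_nonneg.trans hs.1) hs.2]
    exact hf.2.2 s ⟨hs.1, hs.2.trans hrt.le⟩⟩

/-- After the last release, the best alive request stays best until it is reached or expires.
Driving towards it for exactly that long removes it from `alive`, which gives the induction. -/
theorem Itinerary.exists_straight_extension (hgeo : IsGeodesicSpace X) (J : Finset (Request X)) :
    ∀ (N : ℕ) (x : Itinerary O) (r : ℝ), 0 ≤ r → (∀ f ∈ J, f.release ≤ r) →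
      (x.alive J r).card ≤ N → ∃ y : Itinerary O, y.AgreesUntil x r ∧ y.Straight J r := by
  classical
  intro N
  induction N with
  | zero =>
    intro x r hr _ hN
    obtain hN := Finset.card_eq_zero.1 (Nat.le_zero.1 hN)
    refine ⟨x, fun _ _ _ => rfl, fun s t f hs hst hf => ?_⟩
    rcases hst.eq_or_lt with rfl | hst
    · simp
    have hu := hf ((s + t) / 2) ⟨by linarith, by linarith⟩
    have := mem_alive_of_pending (x := x) (r := r) (fun _ _ _ => rfl) (by linarith) hu.1
    simp [hN] at this
  | succ N ih =>
    intro x r hr hJ hN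
    rcases (x.alive J r).eq_empty_or_nonempty with h0 | hne
    · exact ih x r hr hJ (by simp [h0])
    obtain ⟨f, hf, hmax⟩ := (x.alive J r).exists_max_image priority hne
    obtain ⟨hfJ, hfd, hfs⟩ := mem_alive.1 hf
    set d := min (dist (x.pos r) f.loc) (f.deadline - r) with hd
    have hd0 : 0 < d := lt_min (dist_pos.2 (hfs r ⟨hJ f hfJ, le_rfl⟩)) (by linarith)
    obtain ⟨y, hyx, hy, -⟩ := x.exists_extension hgeo hr hd0.le f.loc (min_le_left _ _)
    have hsub : y.alive J (r + d) ⊆ (x.alive J r).erase f := by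
      intro g hg
      obtain ⟨hgJ, hgd, hgs⟩ := mem_alive.1 hg
      refine Finset.mem_erase.2 ⟨?_, mem_alive.2 ⟨hgJ, by linarith, fun s hs => ?_⟩⟩
      · rintro rfl
        have h1 : d = dist (x.pos r) g.loc := by
          refine (min_choice _ _).resolve_right fun h => ?_
          rw [← hd] at h
          linarith
        refine hgs (r + d) ⟨by linarith [hJ g hgJ], le_rfl⟩ (dist_eq_zero.1 ?_)
        rw [hy _ ⟨by linarith, le_rfl⟩, h1]
        ring
      · rw [← hyx s (g.release_nonneg.trans hs.1) hs.2]
        exact hgs s ⟨hs.1, by linarith [hs.2]⟩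
    have hcard : (y.alive J (r + d)).card ≤ N := by
      have := Finset.card_le_card hsub
      rw [Finset.card_erase_of_mem hf] at this
      omega
    obtain ⟨z, hzy, hz⟩ := ih y (r + d) (by linarith) (fun g hg => by linarith [hJ g hg]) hcard
    refine ⟨z, hzy.trans hyx (by linarith), hz.concat ?_⟩
    intro s t g hs hst ht hg
    rcases hst.eq_or_lt with rfl | hst
    · simp
    have hzpos : ∀ u ∈ Set.Icc r (r + d),
        dist (z.pos u) f.loc = dist (x.pos r) f.loc - (u - r) := fun u hu => by
      rw [hzy u (hr.trans hu.1) hu.2, hy u hu]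
    -- An interior time is used because `mem_alive_of_pending` needs a time strictly after `r`.
    have hbest := hg ((s + t) / 2) ⟨by linarith, by linarith⟩
    have hfpend : z.Pending J f ((s + t) / 2) := by
      have h1 : d ≤ f.deadline - r := min_le_right _ _
      have h2 : d ≤ dist (x.pos r) f.loc := min_le_left _ _
      refine ⟨hfJ, ⟨by linarith [hJ f hfJ], by linarith⟩, fun u hu => ?_⟩
      rcases le_total u r with hur | hur
      · rw [hzy.trans hyx (by linarith) u (f.release_nonneg.trans hu.1) hur]
        exact hfs u ⟨hu.1, hur⟩
      · refine dist_pos.1 ?_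
        rw [hzpos u ⟨hur, by linarith [hu.2]⟩]
        linarith [hu.2]
    have hgf : g = f := by
      refine priority_injective (le_antisymm (hmax g ?_) (hbest.2 f hfpend))
      exact mem_alive_of_pending (hzy.trans hyx (by linarith)).symm
        (show r < (s + t) / 2 by linarith) hbest.1
    rw [hgf, hzpos t ⟨by linarith, ht⟩, hzpos s ⟨hs, by linarith⟩]
    ring

/-- The greedy itinerary: at the last release time, the greedy itinerary for the earlier requests
is left for a straight one. -/
noncomputable def greedyRun (hgeo : IsGeodesicSpace X) (O : X) (J : Finset (Request X)) :
    Itinerary O :=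
  if h : J.Nonempty then
    (Itinerary.exists_straight_extension hgeo J _
      (greedyRun hgeo O (releasedBefore J (lastRelease J h))) _ (lastRelease_nonneg h)
      (release_le_lastRelease h) le_rfl).choose
  else Itinerary.stay O
termination_by J.card
decreasing_by exact card_releasedBefore_lt h

theorem greedyRun_spec (hgeo : IsGeodesicSpace X) (O : X) (J : Finset (Request X))
    (h : J.Nonempty) :
    (greedyRun hgeo O J).AgreesUntil
        (greedyRun hgeo O (releasedBefore J (lastRelease J h))) (lastRelease J h) ∧
      (greedyRun hgeo O J).Straight J (lastRelease J h) := by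
  have := (Itinerary.exists_straight_extension hgeo J _
      (greedyRun hgeo O (releasedBefore J (lastRelease J h))) _ (lastRelease_nonneg h)
      (release_le_lastRelease h) le_rfl).choose_spec
  rw [greedyRun, dif_pos h]
  exact this

theorem greedyRun_straight (hgeo : IsGeodesicSpace X) (O : X) (J : Finset (Request X)) :
    (greedyRun hgeo O J).Straight J 0 := by
  induction hN : J.card using Nat.strong_induction_on generalizing J with
  | _ N ih =>
    subst hN
    rcases J.eq_empty_or_nonempty with rfl | h
    · intro s t f _ hst hf
      rcases hst.eq_or_lt with rfl | hst
      · simp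
      · exact absurd (hf s ⟨le_rfl, hst⟩).1.1 (Finset.notMem_empty f)
    obtain ⟨hag, hst⟩ := greedyRun_spec hgeo O J h
    refine hst.concat fun s t f hs hst ht hf => ?_
    rw [hag t (hs.trans hst) ht, hag s hs (hst.trans ht)]
    refine ih _ (card_releasedBefore_lt h) _ rfl s t f hs hst fun u hu => ?_
    have hur : u < lastRelease J h := hu.2.trans_le ht
    refine (hf u hu).congr (hag.mono hur.le) fun g hg => ?_
    rw [mem_releasedBefore, and_iff_left (hg.trans_lt hur)]

/-- As long as the last release of one of the instances is after `t`, its last requests can be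
stripped without changing the position at `t`. When nothing is left to strip, all requests are known
at `t` and the instances are equal. -/
theorem greedyRun_causal (hgeo : IsGeodesicSpace X) (O : X) (I J : Finset (Request X)) (t : ℝ)
    (ht : 0 ≤ t) (hIJ : ∀ f : Request X, f.release ≤ t → (f ∈ I ↔ f ∈ J)) :
    (greedyRun hgeo O I).pos t = (greedyRun hgeo O J).pos t := by
  have reduce : ∀ (K : Finset (Request X)) (h : K.Nonempty), t < lastRelease K h →
      (∀ f : Request X, f.release ≤ t →
        (f ∈ K ↔ f ∈ releasedBefore K (lastRelease K h))) ∧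
      (greedyRun hgeo O K).pos t =
        (greedyRun hgeo O (releasedBefore K (lastRelease K h))).pos t := fun K h hK =>
    ⟨fun f hf => by rw [mem_releasedBefore, and_iff_left (hf.trans_lt hK)],
      (greedyRun_spec hgeo O K h).1 t ht hK.le⟩
  induction hN : I.card + J.card using Nat.strong_induction_on generalizing I J with
  | _ N ih =>
    subst hN
    by_cases hI : ∃ h : I.Nonempty, t < lastRelease I h
    · obtain ⟨h, hlt⟩ := hI
      obtain ⟨h1, h2⟩ := reduce I h hlt
      rw [h2]
      exact ih _ (by have := card_releasedBefore_lt h; omega) _ _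
        (fun f hf => (h1 f hf).symm.trans (hIJ f hf)) rfl
    by_cases hJ : ∃ h : J.Nonempty, t < lastRelease J h
    · obtain ⟨h, hlt⟩ := hJ
      obtain ⟨h1, h2⟩ := reduce J h hlt
      rw [h2]
      exact ih _ (by have := card_releasedBefore_lt h; omega) _ _
        (fun f hf => (hIJ f hf).trans (h1 f hf)) rfl
    have known : ∀ K : Finset (Request X), (¬∃ h : K.Nonempty, t < lastRelease K h) →
        ∀ f ∈ K, f.release ≤ t := fun K hK f hf =>
      (release_le_lastRelease ⟨f, hf⟩ f hf).trans (not_lt.1 fun h => hK ⟨⟨f, hf⟩, h⟩)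
    have : I = J := by
      ext1 f
      exact ⟨fun h => (hIJ f (known I hI f h)).1 h, fun h => (hIJ f (known J hJ f h)).2 h⟩
    rw [this]

theorem exists_isGreedy (hgeo : IsGeodesicSpace X) (O : X) :
    ∃ A : OnlineAlgorithm O, A.IsGreedy :=
  ⟨⟨greedyRun hgeo O, greedyRun_causal hgeo O⟩, fun I => (greedyRun_straight hgeo O I).isGreedy⟩

end

end OPTiWinD

namespace OPTiWinD

/-! ### Performances, ratios and the greedy lower bound -/

section

variable {X : Type*}

/-- The request of weight `1` at `P` at time `r`. -/
def unitRequest (P : X) (r : ℝ) (hr : 0 ≤ r) : Request X := ⟨P, r, 1, hr, one_pos⟩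

theorem instances_nonempty (P : X) {n : ℕ} (hn : 1 ≤ n) (T : ℝ) :
    Nonempty (instances X n T) :=
  ⟨{unitRequest P 0 le_rfl}, Finset.singleton_nonempty _, by simpa using hn, by
    intro f hf g hg hfg
    rw [Finset.mem_singleton] at hf hg
    exact absurd (hf.trans hg.symm) hfg⟩

end

section

variable {X : Type*} [MetricSpace X] {O : X}

/-! ### Performances -/

theorem Itinerary.performance_nonneg (x : Itinerary O) (I : Finset (Request X)) :
    0 ≤ x.performance I :=
  div_nonneg (Finset.sum_nonneg fun f _ => f.weight_pos.le)
    (Finset.sum_nonneg fun f _ => f.weight_pos.le)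

theorem Itinerary.performance_le_one (x : Itinerary O) (I : Finset (Request X)) :
    x.performance I ≤ 1 := by
  classical
  exact div_le_one_of_le₀
    (Finset.sum_le_sum_of_subset_of_nonneg (Finset.filter_subset _ _) fun f _ _ => f.weight_pos.le)
    (Finset.sum_nonneg fun f _ => f.weight_pos.le)

theorem bddAbove_performance (O : X) (I : Finset (Request X)) :
    BddAbove (Set.range fun x : Itinerary O => x.performance I) :=
  ⟨1, by rintro _ ⟨x, rfl⟩; exact x.performance_le_one I⟩

theorem Itinerary.performance_le_offline (x : Itinerary O) (I : Finset (Request X)) :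
    x.performance I ≤ offlinePerformance O I :=
  le_ciSup (bddAbove_performance O I) x

theorem offlinePerformance_nonneg (O : X) (I : Finset (Request X)) :
    0 ≤ offlinePerformance O I :=
  ((Itinerary.stay O).performance_nonneg I).trans ((Itinerary.stay O).performance_le_offline I)

theorem offlinePerformance_le_one (O : X) (I : Finset (Request X)) :
    offlinePerformance O I ≤ 1 :=
  have : Nonempty (Itinerary O) := ⟨Itinerary.stay O⟩
  ciSup_le fun x => x.performance_le_one I

theorem Itinerary.ratio_nonneg (x : Itinerary O) (I : Finset (Request X)) :
    0 ≤ x.performance I / offlinePerformance O I :=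
  div_nonneg (x.performance_nonneg I) (offlinePerformance_nonneg O I)

theorem Itinerary.ratio_le_one (x : Itinerary O) (I : Finset (Request X)) :
    x.performance I / offlinePerformance O I ≤ 1 :=
  div_le_one_of_le₀ (x.performance_le_offline I) (offlinePerformance_nonneg O I)

theorem Itinerary.performance_eq_zero {x : Itinerary O} {I : Finset (Request X)}
    (h : ∀ f ∈ I, ¬x.Serves f) : x.performance I = 0 := by
  classical
  rw [Itinerary.performance, Finset.sum_eq_zero, zero_div]
  intro f hf
  exact absurd (Finset.mem_filter.1 hf).2 (h f (Finset.mem_filter.1 hf).1)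

theorem Itinerary.performance_eq_one {x : Itinerary O} {I : Finset (Request X)}
    (hI : I.Nonempty) (h : ∀ f ∈ I, x.Serves f) : x.performance I = 1 := by
  classical
  rw [Itinerary.performance, Finset.filter_true_of_mem h, div_self]
  exact (Finset.sum_pos (fun f _ => f.weight_pos) hI).ne'

theorem Itinerary.performance_le_inv_card {x : Itinerary O} {I : Finset (Request X)}
    (hw : ∀ f ∈ I, f.weight = 1)
    (h : ∀ f ∈ I, ∀ g ∈ I, x.Serves f → x.Serves g → f = g) :
    x.performance I ≤ 1 / (I.card : ℝ) := by
  classical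
  have h1 : ∑ f ∈ I, f.weight = (I.card : ℝ) := by
    rw [Finset.sum_congr rfl hw]; simp
  have h2 : ∑ f ∈ I with x.Serves f, f.weight ≤ 1 := by
    rw [Finset.sum_congr rfl fun f hf => hw f (Finset.mem_filter.1 hf).1]
    have : (I.filter fun f => x.Serves f).card ≤ 1 := by
      refine Finset.card_le_one.2 fun f hf g hg => ?_
      rw [Finset.mem_filter] at hf hg
      exact h f hf.1 g hg.1 hf.2 hg.2
    simpa using this
  rw [Itinerary.performance]
  rw [h1]
  refine div_le_div_of_nonneg_right ?_ (Nat.cast_nonneg (α := ℝ) I.card)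
  convert h2

/-- A greedy itinerary serves a request of greatest weight. -/
theorem Itinerary.IsGreedy.exists_serves {x : Itinerary O} {I : Finset (Request X)}
    (hdist : ∀ p q : X, dist p q ≤ 2) (hx : x.IsGreedy I) (hI : I.Nonempty) :
    ∃ f ∈ I, x.Serves f ∧ ∀ g ∈ I, g.weight ≤ f.weight := by
  classical
  obtain ⟨m, hm, hmax⟩ := I.exists_max_image Request.weight hI
  obtain ⟨f, hf, hmin⟩ := (I.filter fun f => f.weight = m.weight).exists_min_image
    Request.release ⟨m, Finset.mem_filter.2 ⟨hm, rfl⟩⟩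
  rw [Finset.mem_filter] at hf
  by_contra! hcon
  have hno : ∀ g ∈ I, g.weight = m.weight → ¬x.Serves g := by
    intro g hg hgw hs
    obtain ⟨k, hk, hlt⟩ := hcon g hg hs
    exact absurd (hmax k hk) (not_le.2 (hgw ▸ hlt))
  have hpend : ∀ g ∈ I, g.weight = m.weight → ∀ t ∈ Set.Icc g.release g.deadline,
      x.Pending I g t := fun g hg hgw t ht =>
    ⟨hg, ht, fun s hs he => hno g hg hgw ⟨s, ⟨hs.1, hs.2.trans ht.2⟩, he⟩⟩
  have hdl : ∀ g : Request X, g.deadline = g.release + 2 := fun _ => rfl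
  obtain ⟨dest, h1, h2, h3, h4⟩ := hx
  -- No heaviest request is released before `f`, so the destination `g` chosen at this time has the
  -- weight and release time of `f`. Under the contrary assumption it stays pending and heaviest
  -- during its whole window.
  have hr := f.release_nonneg
  have hfp := hpend f hf.1 hf.2 f.release ⟨le_rfl, by rw [hdl]; linarith⟩
  obtain ⟨g, hg⟩ := h2 _ hr f hfp
  have hgh := h1 _ hr g hg
  have hgI := hgh.1.1
  have hgw : g.weight = m.weight := le_antisymm (hmax g hgI) (hf.2 ▸ hgh.2 f hfp)
  have hgr : g.release = f.release :=
    le_antisymm hgh.1.2.1.1 (hmin g (Finset.mem_filter.2 ⟨hgI, hgw⟩))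
  have hdest : ∀ u ∈ Set.Icc f.release (f.release + 2), dest u = some g := by
    intro u hu
    refine h3 _ u hr hu.1 g hg fun v hv => ⟨hpend g hgI hgw v ?_, fun k hk => ?_⟩
    · rw [hdl, hgr]
      exact ⟨hv.1, hv.2.trans hu.2⟩
    · rw [hgw]
      exact hmax k hk.1
  have hend := h4 _ _ hr (by linarith : f.release ≤ f.release + 2) g hdest
  refine hno g hgI hgw ⟨f.release + 2, ?_, dist_le_zero.1 ?_⟩
  · rw [hdl, hgr]
    exact ⟨by linarith, le_rfl⟩
  · linarith [hdist (x.pos f.release) g.loc]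

theorem Itinerary.IsGreedy.inv_le_performance {x : Itinerary O} {I : Finset (Request X)} {n : ℕ}
    (hdist : ∀ p q : X, dist p q ≤ 2) (hx : x.IsGreedy I) (hI : I.Nonempty) (hn : I.card ≤ n) :
    1 / (n : ℝ) ≤ x.performance I := by
  classical
  obtain ⟨f, hf, hs, hmax⟩ := hx.exists_serves hdist hI
  have hc : (0 : ℝ) < n := by exact_mod_cast (Finset.card_pos.2 hI).trans_le hn
  have h1 : f.weight ≤ ∑ g ∈ I with x.Serves g, g.weight :=
    Finset.single_le_sum (f := Request.weight) (fun g _ => g.weight_pos.le)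
      (Finset.mem_filter.2 ⟨hf, hs⟩)
  have h2 : ∑ g ∈ I, g.weight ≤ n * f.weight := by
    have := Finset.sum_le_card_nsmul I Request.weight f.weight hmax
    rw [nsmul_eq_mul] at this
    refine this.trans (mul_le_mul_of_nonneg_right (by exact_mod_cast hn) f.weight_pos.le)
  have h3 : 0 < ∑ g ∈ I, g.weight := Finset.sum_pos (fun g _ => g.weight_pos) hI
  rw [Itinerary.performance, div_le_div_iff₀ hc h3, one_mul]
  refine h2.trans ?_
  rw [mul_comm]
  convert mul_le_mul_of_nonneg_right h1 hc.le using 2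

theorem Itinerary.IsGreedy.inv_le_ratio {x : Itinerary O} {I : Finset (Request X)} {n : ℕ}
    (hdist : ∀ p q : X, dist p q ≤ 2) (hx : x.IsGreedy I) (hI : I.Nonempty) (hn : I.card ≤ n) :
    1 / (n : ℝ) ≤ x.performance I / offlinePerformance O I := by
  have h := hx.inv_le_performance hdist hI hn
  have hc : (0 : ℝ) < n := by exact_mod_cast (Finset.card_pos.2 hI).trans_le hn
  have hpos : 0 < x.performance I := (one_div_pos.2 hc).trans_le h
  refine h.trans (le_div_self hpos.le (hpos.trans_le (x.performance_le_offline I))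
    (offlinePerformance_le_one O I))

theorem OnlineAlgorithm.performance_le (A : OnlineAlgorithm O) {n : ℕ} {T : ℝ}
    {I : Finset (Request X)} (hI : I ∈ instances X n T) :
    A.performance n T ≤ (A.run I).performance I :=
  ciInf_le (f := fun I : instances X n T => (A.run I.1).performance I.1)
    ⟨0, by rintro _ ⟨J, rfl⟩; exact Itinerary.performance_nonneg _ _⟩ ⟨I, hI⟩

theorem OnlineAlgorithm.competitiveRatio_le (A : OnlineAlgorithm O) {n : ℕ} {T : ℝ}
    {I : Finset (Request X)} (hI : I ∈ instances X n T) :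
    A.competitiveRatio n T ≤ (A.run I).performance I / offlinePerformance O I :=
  ciInf_le (f := fun I : instances X n T =>
      (A.run I.1).performance I.1 / offlinePerformance O I.1)
    ⟨0, by rintro _ ⟨J, rfl⟩; exact Itinerary.ratio_nonneg _ _⟩ ⟨I, hI⟩

theorem OnlineAlgorithm.IsGreedy.inv_le_performance {A : OnlineAlgorithm O}
    (hdist : ∀ p q : X, dist p q ≤ 2) (hA : A.IsGreedy) {n : ℕ} (hn : 1 ≤ n) (T : ℝ) :
    1 / (n : ℝ) ≤ A.performance n T :=
  have := instances_nonempty O hn T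
  le_ciInf fun I => (hA I.1).inv_le_performance hdist I.2.1 I.2.2.1

theorem OnlineAlgorithm.IsGreedy.inv_le_competitiveRatio {A : OnlineAlgorithm O}
    (hdist : ∀ p q : X, dist p q ≤ 2) (hA : A.IsGreedy) {n : ℕ} (hn : 1 ≤ n) (T : ℝ) :
    1 / (n : ℝ) ≤ A.competitiveRatio n T :=
  have := instances_nonempty O hn T
  le_ciInf fun I => (hA I.1).inv_le_ratio hdist I.2.1 I.2.2.1

/-- If no algorithm has a performance greater than `1 / n`, this is the optimal performance. -/
theorem optimalPerformance_eq (hgeo : IsGeodesicSpace X) (hdist : ∀ p q : X, dist p q ≤ 2) {n : ℕ}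
    (hn : 1 ≤ n) {T : ℝ} (h : ∀ A : OnlineAlgorithm O, A.performance n T ≤ 1 / (n : ℝ)) :
    optimalPerformance O n T = 1 / (n : ℝ) := by
  obtain ⟨A, hA⟩ := exists_isGreedy hgeo O
  have : Nonempty (OnlineAlgorithm O) := ⟨A⟩
  exact le_antisymm (ciSup_le h) ((hA.inv_le_performance hdist hn T).trans
    (le_ciSup (f := fun A : OnlineAlgorithm O => A.performance n T)
      ⟨1 / (n : ℝ), by rintro _ ⟨B, rfl⟩; exact h B⟩ A))

/-- If no algorithm has a competitive ratio greater than `1 / n`, this is the optimal competitive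
ratio, and greedy algorithms attain it. -/
theorem optimalCompetitiveRatio_eq (hgeo : IsGeodesicSpace X) (hdist : ∀ p q : X, dist p q ≤ 2)
    {n : ℕ} (hn : 1 ≤ n) {T : ℝ}
    (h : ∀ A : OnlineAlgorithm O, A.competitiveRatio n T ≤ 1 / (n : ℝ)) :
    (∀ A : OnlineAlgorithm O, A.IsGreedy → A.IsOptimal n T) ∧
      optimalCompetitiveRatio O n T = 1 / (n : ℝ) := by
  obtain ⟨A, hA⟩ := exists_isGreedy hgeo O
  have : Nonempty (OnlineAlgorithm O) := ⟨A⟩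
  have heq : optimalCompetitiveRatio O n T = 1 / (n : ℝ) :=
    le_antisymm (ciSup_le h) ((hA.inv_le_competitiveRatio hdist hn T).trans
      (le_ciSup (f := fun A : OnlineAlgorithm O => A.competitiveRatio n T)
        ⟨1 / (n : ℝ), by rintro _ ⟨B, rfl⟩; exact h B⟩ A))
  refine ⟨fun B hB => ?_, heq⟩
  rw [OnlineAlgorithm.IsOptimal, heq]
  exact le_antisymm (h B) (hB.inv_le_competitiveRatio hdist hn T)

end

end OPTiWinD

namespace OPTiWinD

section

variable {X : Type*} [MetricSpace X] {O : X}

/-! ### The adversary -/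

/-- The request `f` has not been served up to time `t` and can no longer be reached in time. -/
def Itinerary.Lost (x : Itinerary O) (f : Request X) (t : ℝ) : Prop :=
  (∀ s ∈ Set.Icc f.release f.deadline, s ≤ t → x.pos s ≠ f.loc) ∧ f.deadline - t < dist (x.pos t) f.loc

theorem Itinerary.Lost.congr {x y : Itinerary O} {f : Request X} {t : ℝ} (ht : 0 ≤ t)
    (hxy : x.AgreesUntil y t) (h : x.Lost f t) : y.Lost f t := by
  refine ⟨fun s hs hst => ?_, ?_⟩
  · rw [← hxy s (f.release_nonneg.trans hs.1) hst]
    exact h.1 s hs hst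
  · rw [← hxy t ht le_rfl]
    exact h.2

theorem Itinerary.Lost.not_serves {x : Itinerary O} {f : Request X} {t : ℝ} (ht : 0 ≤ t)
    (h : x.Lost f t) : ¬x.Serves f := by
  rintro ⟨s, hs, he⟩
  rcases le_total s t with hst | hst
  · exact h.1 s hs hst he
  · have := x.speed t s ht hst
    rw [he] at this
    linarith [h.2, hs.2]

theorem Itinerary.Lost.mono {x : Itinerary O} {f : Request X} {t t' : ℝ} (ht : 0 ≤ t)
    (htt' : t ≤ t') (h : x.Lost f t) : x.Lost f t' := by
  refine ⟨fun s hs _ he => h.not_serves ht ⟨s, hs, he⟩, ?_⟩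
  linarith [x.dist_sub_le ht htt' f.loc, h.2]

/-- The request `f` is served not later than `τ`. -/
def Itinerary.ServesBy (x : Itinerary O) (f : Request X) (τ : ℝ) : Prop :=
  ∃ t ∈ Set.Icc f.release f.deadline, t ≤ τ ∧ x.pos t = f.loc

theorem Itinerary.ServesBy.congr {x y : Itinerary O} {f : Request X} {τ τ' : ℝ}
    (hxy : x.AgreesUntil y τ) (hτ : τ ≤ τ') (h : x.ServesBy f τ) : y.ServesBy f τ' := by
  obtain ⟨t, ht, htτ, he⟩ := h
  exact ⟨t, ht, htτ.trans hτ, by rw [← hxy t (f.release_nonneg.trans ht.1) htτ, he]⟩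

/-- A new request does not influence an algorithm before it is released. -/
theorem OnlineAlgorithm.agreesUntil_insert [DecidableEq (Request X)] (A : OnlineAlgorithm O)
    (I : Finset (Request X)) (c : Request X) :
    (A.run I).AgreesUntil (A.run (insert c I)) c.release := by
  have hlt : ∀ s, 0 ≤ s → s < c.release → (A.run I).pos s = (A.run (insert c I)).pos s := by
    intro s hs hsc
    refine A.causal _ _ s hs fun f hf => ?_
    have : f ≠ c := by rintro rfl; linarith
    simp [this]
  intro s hs hsc
  rcases hsc.lt_or_eq with hsc | rfl
  · exact hlt s hs hsc
  rcases hs.eq_or_lt with h0 | h0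
  · rw [← h0, Itinerary.start, Itinerary.start]
  -- At the release time itself causality says nothing; the positions agree by continuity.
  refine dist_le_zero.1 (le_of_forall_pos_le_add fun δ hδ => ?_)
  set u := max 0 (c.release - δ / 2)
  have hu0 : 0 ≤ u := le_max_left _ _
  have hu1 : c.release - δ / 2 ≤ u := le_max_right _ _
  have huc : u < c.release := max_lt h0 (by linarith)
  have h1 := (A.run I).speed u _ hu0 huc.le
  have h2 := (A.run (insert c I)).speed u _ hu0 huc.le
  rw [← hlt u hu0 huc] at h2
  have := dist_triangle_left ((A.run I).pos c.release) ((A.run (insert c I)).pos c.release)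
    ((A.run I).pos u)
  linarith

/-- If two distant requests are pending, then within a short time of some instant at which one of
them becomes lost, the vehicle has not come near any of them. -/
theorem Itinerary.exists_loss (x : Itinerary O) {a b : Request X} {σ w e e' : ℝ}
    (hab : a.release ≤ b.release) (hσ : 0 < σ) (hL : 2 - σ ≤ dist a.loc b.loc) (hw0 : 0 ≤ w)
    (hw : e' + 2 * σ ≤ w) (he : w + e' + σ ≤ e)
    (ha : e ≤ dist (x.pos b.release) a.loc) (hb : e ≤ dist (x.pos b.release) b.loc) :
    ∃ t, b.release + w ≤ t ∧
      (a.deadline - t < dist (x.pos t) a.loc ∨ b.deadline - t < dist (x.pos t) b.loc) ∧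
      ∀ s ∈ Set.Icc b.release t, e' ≤ dist (x.pos s) a.loc ∧ e' ≤ dist (x.pos s) b.loc := by
  have hr := b.release_nonneg
  have hda : a.deadline = a.release + 2 := rfl
  have hdb : b.deadline = b.release + 2 := rfl
  set S : Set ℝ := {t | b.release + w ≤ t ∧
    (a.deadline - t < dist (x.pos t) a.loc ∨ b.deadline - t < dist (x.pos t) b.loc)} with hS
  have hne : S.Nonempty := by
    refine ⟨b.release + w + 3, by linarith, Or.inr ?_⟩
    refine lt_of_lt_of_le ?_ dist_nonneg
    linarith
  have hbdd : BddBelow S := ⟨b.release + w, fun t ht => ht.1⟩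
  -- The infimum need not be attained, so `t` is only taken within `σ` of it.
  obtain ⟨t, htS, ht⟩ := exists_lt_of_csInf_lt hne (show sInf S < sInf S + σ by linarith)
  refine ⟨t, htS.1, htS.2, fun s hs => ?_⟩
  rcases le_total (s - σ) (b.release + w) with hsw | hsw
  · have h1 := x.dist_sub_le hr hs.1 a.loc
    have h2 := x.dist_sub_le hr hs.1 b.loc
    constructor <;> linarith
  -- At time `s - σ` both requests are still reachable. Being close to one would put the other,
  -- nearly 2 away, out of reach, since at least `w` has elapsed since the release of `b`.
  · have hnot : s - σ ∉ S := notMem_of_lt_csInf (by linarith [hs.2]) hbdd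
    have hnot' : dist (x.pos (s - σ)) a.loc ≤ a.deadline - (s - σ) ∧
        dist (x.pos (s - σ)) b.loc ≤ b.deadline - (s - σ) := by
      by_contra hcon
      refine hnot ⟨hsw, ?_⟩
      rw [not_and_or, not_le, not_le] at hcon
      exact hcon
    have h1 := x.dist_sub_le (show 0 ≤ s - σ by linarith) (show s - σ ≤ s by linarith) a.loc
    have h2 := x.dist_sub_le (show 0 ≤ s - σ by linarith) (show s - σ ≤ s by linarith) b.loc
    have h3 := dist_triangle_left a.loc b.loc (x.pos (s - σ))
    constructor <;> linarith [hnot'.1, hnot'.2]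

/-- A vehicle outside the ball of radius `e` around `P` either stays outside for ever, or there is a
first time at which its distance from `P` is `e`. -/
theorem Itinerary.exists_first_hit (x : Itinerary O) (P : X) {e r : ℝ} (hr : 0 ≤ r)
    (he : e ≤ dist (x.pos r) P) :
    (∀ s, r ≤ s → e < dist (x.pos s) P) ∨
      ∃ t, r ≤ t ∧ dist (x.pos t) P = e ∧ ∀ s ∈ Set.Icc r t, e ≤ dist (x.pos s) P := by
  by_contra! hcon
  obtain ⟨⟨t', hrt', ht'⟩, hcon⟩ := hcon
  have hcont : ContinuousOn (fun s => dist (x.pos s) P) (Set.Icc r t') :=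
    (x.continuousOn_dist P).mono fun s hs => hr.trans hs.1
  have hcomp : IsCompact (Set.Icc r t' ∩ (fun s => dist (x.pos s) P) ⁻¹' Set.Iic e) :=
    isCompact_Icc.of_isClosed_subset
      (hcont.preimage_isClosed_of_isClosed isClosed_Icc isClosed_Iic) Set.inter_subset_left
  obtain ⟨t, ⟨⟨hrt, htt'⟩, hte⟩, hleast⟩ := hcomp.exists_isLeast ⟨t', ⟨hrt', le_rfl⟩, ht'⟩
  have hte : dist (x.pos t) P ≤ e := hte
  have hbefore : ∀ s, r ≤ s → s < t → e < dist (x.pos s) P := fun s hrs hst =>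
    lt_of_not_ge fun h => absurd (hleast ⟨⟨hrs, hst.le.trans htt'⟩, h⟩) (not_le.2 hst)
  have hte' : e ≤ dist (x.pos t) P := by
    by_contra! hlt
    rcases hrt.eq_or_lt with rfl | hrt
    · exact absurd he (not_le.2 hlt)
    set s := max r (t - (e - dist (x.pos t) P))
    have hst : s < t := max_lt hrt (by linarith)
    have h1 := x.speed s t (hr.trans (le_max_left _ _)) hst.le
    have h2 := dist_triangle (x.pos s) (x.pos t) P
    have h3 : t - (e - dist (x.pos t) P) ≤ s := le_max_right _ _
    linarith [hbefore s (le_max_left _ _) hst]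
  obtain ⟨s, hs, hse⟩ := hcon t hrt (le_antisymm hte hte')
  rcases hs.2.lt_or_eq with hst | rfl
  · linarith [hbefore s hs.1 hst]
  · linarith

/-- The algorithm is defeated on an instance of at most `n` requests: it serves none of them, or at
most one of `n` requests all of which can be served if `P` holds. -/
def OnlineAlgorithm.Defeated (A : OnlineAlgorithm O) (n : ℕ) (T : ℝ) (P : Prop) : Prop :=
  ∃ I ∈ instances X n T, (∀ f ∈ I, f.weight = 1) ∧
    ((∀ f ∈ I, ¬(A.run I).Serves f) ∨
      (I.card = n ∧
        (∀ f ∈ I, ∀ g ∈ I, (A.run I).Serves f → (A.run I).Serves g → f = g) ∧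
        (P → ∃ y : Itinerary O, ∀ f ∈ I, y.Serves f)))

/-- A position of the game against the algorithm `A`: at the release time of `b`, the requests `a`
and `b` of `I` are pending and all others are lost; the vehicle has distance at least `e` from `a`;
and, if `P` holds, an offline itinerary can be at `a` at an earlier time `τ` after it has served all
requests but some at the location of `b`. -/
structure OnlineAlgorithm.Pursuit (A : OnlineAlgorithm O) (P : Prop) (L T e φ : ℝ)
    (I : Finset (Request X)) (a b : Request X) : Prop where
  mem_a : a ∈ I
  mem_b : b ∈ I
  ne : a ≠ b
  weight : ∀ f ∈ I, f.weight = 1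
  gap : ∀ f ∈ I, ∀ g ∈ I, f ≠ g → T ≤ |f.release - g.release|
  last : ∀ f ∈ I, f.release ≤ b.release
  dist_eq : dist a.loc b.loc = L
  lost : ∀ f ∈ I, f ≠ a → f ≠ b → (A.run I).Lost f b.release
  unserved : ∀ s ∈ Set.Icc a.release b.release, (A.run I).pos s ≠ a.loc
  far_a : e ≤ dist ((A.run I).pos b.release) a.loc
  far_b : L / 2 ≤ dist ((A.run I).pos b.release) b.loc
  -- The exceptional requests are all served by one visit to `b.loc` at time `max (τ + L)
  -- b.release`. The number `φ` is the offline lead: even going straight to `a`, the online vehicle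
  -- would arrive at least `φ` plus twice its current distance to `a` after `τ`.
  offline : P → ∃ (y : Itinerary O) (τ : ℝ), 0 ≤ τ ∧ y.pos τ = a.loc ∧
    (∀ f ∈ I, y.ServesBy f τ ∨ (f.loc = b.loc ∧ τ ≤ f.release ∧ b.release ≤ f.deadline)) ∧
    φ ≤ b.release - τ - dist ((A.run I).pos b.release) a.loc

/-! ### Moves and end of the game -/

namespace OnlineAlgorithm.Pursuit

variable {A : OnlineAlgorithm O} {P : Prop} {L T e φ : ℝ} {I : Finset (Request X)}
  {a b : Request X}

theorem mem_instances (h : A.Pursuit P L T e φ I a b) {n : ℕ} (hn : I.card ≤ n) :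
    I ∈ instances X n T :=
  ⟨⟨a, h.mem_a⟩, hn, h.gap⟩

theorem defeated_of_not_serves (h : A.Pursuit P L T e φ I a b) {n : ℕ} (hn : I.card ≤ n)
    (ha : ¬(A.run I).Serves a) (hb : ¬(A.run I).Serves b) : A.Defeated n T P := by
  refine ⟨I, h.mem_instances hn, h.weight, Or.inl fun f hf => ?_⟩
  by_cases hfa : f = a
  · rwa [hfa]
  by_cases hfb : f = b
  · rwa [hfb]
  exact (h.lost f hf hfa hfb).not_serves b.release_nonneg

/-- The offline itinerary can go on to the location of `b`. -/
theorem exists_offline (hgeo : IsGeodesicSpace X) (h : A.Pursuit P L T e φ I a b) (hL : L ≤ 2)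
    {y : Itinerary O} {τ : ℝ} (hτ : 0 ≤ τ) (hy : y.pos τ = a.loc)
    (hserves : ∀ f ∈ I,
      y.ServesBy f τ ∨ (f.loc = b.loc ∧ τ ≤ f.release ∧ b.release ≤ f.deadline)) :
    ∃ z : Itinerary O, z.pos (max (τ + L) b.release) = b.loc ∧
      ∀ f ∈ I, z.ServesBy f (max (τ + L) b.release) := by
  have hL0 : 0 ≤ L := h.dist_eq ▸ dist_nonneg
  have hyL : dist (y.pos τ) b.loc = L := by rw [hy, h.dist_eq]
  obtain ⟨z, hzy, hz, hstay⟩ := y.exists_extension hgeo hτ hL0 b.loc hyL.ge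
  have hzb : z.pos (max (τ + L) b.release) = b.loc := by
    rw [hstay _ (le_max_left _ _)]
    refine dist_eq_zero.1 ?_
    rw [hz _ ⟨by linarith, le_rfl⟩, hyL]
    ring
  refine ⟨z, hzb, fun f hf => ?_⟩
  rcases hserves f hf with hs | ⟨hloc, hτf, hd⟩
  · exact hs.congr hzy.symm (le_trans (by linarith) (le_max_left _ _))
  · refine ⟨_, ⟨(h.last f hf).trans (le_max_right _ _), max_le ?_ hd⟩, le_rfl, hzb.trans hloc.symm⟩
    change τ + L ≤ f.release + 2
    linarith

/-- In a position of the game, at most one request will be served. -/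
theorem serves_unique (h : A.Pursuit P L T e φ I a b) (hL : 4 / 3 < L) (he : 2 < e + L) :
    ∀ f ∈ I, ∀ g ∈ I, (A.run I).Serves f → (A.run I).Serves g → f = g := by
  set x := A.run I
  have hr := b.release_nonneg
  have hab := h.last a h.mem_a
  have key : ¬(x.Serves a ∧ x.Serves b) := by
    rintro ⟨⟨s, hs, hsa⟩, ⟨t, ht, htb⟩⟩
    have hbs : b.release < s := by
      by_contra! hsb
      exact h.unserved s ⟨hs.1, hsb⟩ hsa
    have hs2 : s ≤ a.release + 2 := hs.2
    have ht2 : t ≤ b.release + 2 := ht.2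
    have hLab := h.dist_eq
    -- Both deadlines are at most `b.release + 2`. Going to `a` and then to `b` takes at least `e +
    -- L` from `b.release`, the other order at least `L / 2 + L`; both exceed 2.
    rcases le_total s t with hst | hst
    · have h1 := x.dist_sub_le hr hbs.le a.loc
      have h2 := x.speed s t (hr.trans hbs.le) hst
      rw [hsa, dist_self] at h1
      rw [hsa, htb] at h2
      linarith [h.far_a]
    · have h1 := x.dist_sub_le hr ht.1 b.loc
      have h2 := x.speed t s (hr.trans ht.1) hst
      rw [htb, dist_self] at h1
      rw [hsa, htb, dist_comm] at h2
      linarith [h.far_b]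
  have hcases : ∀ f ∈ I, x.Serves f → f = a ∨ f = b := by
    intro f hf hs
    by_contra! hcon
    exact (h.lost f hf hcon.1 hcon.2).not_serves hr hs
  intro f hf g hg hsf hsg
  rcases hcases f hf hsf with rfl | rfl <;> rcases hcases g hg hsg with rfl | rfl
  · rfl
  · exact absurd ⟨hsf, hsg⟩ key
  · exact absurd ⟨hsg, hsf⟩ key
  · rfl

theorem defeated (hgeo : IsGeodesicSpace X) (h : A.Pursuit P L T e φ I a b) (hL2 : L ≤ 2)
    (hL : 4 / 3 < L) (he : 2 < e + L) : A.Defeated I.card T P := by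
  refine ⟨I, h.mem_instances le_rfl, h.weight, Or.inr ⟨rfl, h.serves_unique hL he, fun hP => ?_⟩⟩
  obtain ⟨y, τ, hτ, hy, hserves, -⟩ := h.offline hP
  obtain ⟨z, -, hz⟩ := h.exists_offline hgeo hL2 hτ hy hserves
  refine ⟨z, fun f hf => ?_⟩
  obtain ⟨t, ht, -, hzt⟩ := hz f hf
  exact ⟨t, ht, hzt⟩

/-- The adversary releases one more request. -/
theorem exists_next (hgeo : IsGeodesicSpace X) (h : A.Pursuit P L T e φ I a b)
    {σ w e' φ' : ℝ} (hL2 : L ≤ 2) (hσ : 0 < σ) (hL : 2 - σ ≤ L) (he' : 0 < e') (heL : e ≤ L / 2)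
    (hTw : T ≤ w) (hw : e' + 2 * σ ≤ w) (hwe : w + e' + σ ≤ e) (hφ' : 0 ≤ φ')
    (hφ : φ = φ' + 2 * e') (hφL : P → φ ≤ L / 2) {n : ℕ} (hn : I.card ≤ n) :
    A.Defeated n T P ∨ ∃ (J : Finset (Request X)) (a' b' : Request X),
      J.card = I.card + 1 ∧ A.Pursuit P L T e' φ' J a' b' := by
  classical
  set x := A.run I with hx
  have hr := b.release_nonneg
  have hab := h.last a h.mem_a
  have hLab := h.dist_eq
  have hda : a.deadline = a.release + 2 := rfl
  have hdb : b.deadline = b.release + 2 := rfl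
  have hloc : a.loc ≠ b.loc := dist_pos.1 (by rw [hLab]; linarith)
  obtain ⟨t, hbt, hloss, hfar⟩ := x.exists_loss hab hσ (hLab ▸ hL) (by linarith) hw hwe h.far_a
    (heL.trans h.far_b)
  have hbt' : b.release ≤ t := by linarith
  have ht0 : 0 ≤ t := hr.trans hbt'
  have hua : ∀ s ∈ Set.Icc a.release t, x.pos s ≠ a.loc := by
    intro s hs
    rcases le_total s b.release with hsb | hsb
    · exact h.unserved s ⟨hs.1, hsb⟩
    · exact dist_pos.1 (he'.trans_le (hfar s ⟨hsb, hs.2⟩).1)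
  have hub : ∀ s ∈ Set.Icc b.release t, x.pos s ≠ b.loc := fun s hs =>
    dist_pos.1 (he'.trans_le (hfar s hs).2)
  have hlosta : a.deadline - t < dist (x.pos t) a.loc → x.Lost a t := fun hl =>
    ⟨fun s hs hst => hua s ⟨hs.1, hst⟩, hl⟩
  have hlostb : b.deadline - t < dist (x.pos t) b.loc → x.Lost b t := fun hl =>
    ⟨fun s hs hst => hub s ⟨hs.1, hst⟩, hl⟩
  -- the facts that do not depend on the location of the new request
  have hnew : ∀ c : Request X, b.release + w ≤ c.release → c.weight = 1 →
      (∀ f ∈ I, f ≠ c) ∧ (insert c I).card = I.card + 1 ∧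
      (∀ f ∈ insert c I, f.weight = 1) ∧
      (∀ f ∈ insert c I, ∀ g ∈ insert c I, f ≠ g → T ≤ |f.release - g.release|) ∧
      (∀ f ∈ insert c I, f.release ≤ c.release) := by
    intro c hc hcw
    have hlt : ∀ f ∈ I, f.release + w ≤ c.release := fun f hf => by linarith [h.last f hf]
    have hne : ∀ f ∈ I, f ≠ c := by
      rintro f hf rfl
      linarith [hlt f hf]
    refine ⟨hne, Finset.card_insert_of_notMem fun hcI => hne c hcI rfl, ?_, ?_, ?_⟩
    · intro f hf
      rcases Finset.mem_insert.1 hf with rfl | hf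
      exacts [hcw, h.weight f hf]
    · intro f hf g hg hfg
      rcases Finset.mem_insert.1 hf with hf' | hf' <;> rcases Finset.mem_insert.1 hg with hg' | hg'
      · exact absurd (hf'.trans hg'.symm) hfg
      · rw [hf']
        exact le_trans (by linarith [hlt g hg']) (le_abs_self _)
      · rw [hg', abs_sub_comm]
        exact le_trans (by linarith [hlt f hf']) (le_abs_self _)
      · exact h.gap f hf' g hg' hfg
    · intro f hf
      rcases Finset.mem_insert.1 hf with rfl | hf
      exacts [le_rfl, by linarith [hlt f hf]]
  -- At least one of `a`, `b` is lost. If only `a` is, the roles are exchanged once the vehicle is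
  -- at distance `e'` from `b`; if only `b` is, it is renewed at once.
  by_cases hla : a.deadline - t < dist (x.pos t) a.loc
  · by_cases hlb : b.deadline - t < dist (x.pos t) b.loc
    · exact Or.inl (h.defeated_of_not_serves hn ((hlosta hla).not_serves ht0)
        ((hlostb hlb).not_serves ht0))
    rcases x.exists_first_hit b.loc ht0 (hfar t ⟨hbt', le_rfl⟩).2 with hnever | ⟨t', htt', hhit, hout⟩
    · refine Or.inl (h.defeated_of_not_serves hn ((hlosta hla).not_serves ht0) ?_)
      rintro ⟨s, hs, hsb⟩
      rcases le_total s t with hst | hst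
      · exact hub s ⟨hs.1, hst⟩ hsb
      · have := hnever s hst
        rw [hsb, dist_self] at this
        linarith
    right
    have ht'0 : 0 ≤ t' := ht0.trans htt'
    set c := unitRequest a.loc t' ht'0
    obtain ⟨hne, hcard, hweight, hgap, hlast⟩ := hnew c (hbt.trans htt') rfl
    have hag : x.AgreesUntil (A.run (insert c I)) t' := A.agreesUntil_insert I c
    have hpos : (A.run (insert c I)).pos c.release = x.pos t' := (hag t' ht'0 le_rfl).symm
    refine ⟨insert c I, b, c, hcard,
      ⟨Finset.mem_insert_of_mem h.mem_b, Finset.mem_insert_self _ _, hne b h.mem_b, hweight, hgap,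
        hlast, by rw [dist_comm]; exact hLab, ?_, ?_, ?_, ?_, ?_⟩⟩
    · intro f hf hfb hfc
      have hfI := (Finset.mem_insert.1 hf).resolve_left hfc
      by_cases hfa : f = a
      · rw [hfa]
        exact ((hlosta hla).mono ht0 htt').congr ht'0 hag
      · exact ((h.lost f hfI hfa hfb).mono hr (hbt'.trans htt')).congr ht'0 hag
    · intro s hs
      rw [← hag s (hr.trans hs.1) hs.2]
      rcases le_total s t with hst | hst
      · exact hub s ⟨hs.1, hst⟩
      · exact dist_pos.1 (he'.trans_le (hout s ⟨hst, hs.2⟩))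
    · rw [hpos, hhit]
    · rw [hpos]
      change L / 2 ≤ dist (x.pos t') a.loc
      linarith [dist_triangle_left a.loc b.loc (x.pos t')]
    · intro hP
      obtain ⟨y, τ, hτ, hy, hserves, hphi⟩ := h.offline hP
      obtain ⟨z, hz, hzs⟩ := h.exists_offline hgeo hL2 hτ hy hserves
      have h1 := x.dist_sub_le hr (hbt'.trans htt') b.loc
      have h2 := dist_triangle_left a.loc b.loc (x.pos b.release)
      have h3 := hφL hP
      have hmax : max (τ + L) b.release ≤ t' - e' - φ' :=
        max_le (by linarith) (by linarith [h.far_b])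
      refine ⟨z, _, le_max_of_le_right hr, hz, fun f hf => ?_, ?_⟩
      · rcases Finset.mem_insert.1 hf with rfl | hf
        · refine Or.inr ⟨rfl, ?_, ?_⟩
          · change _ ≤ t'
            linarith
          · change t' ≤ t' + 2
            linarith
        · exact Or.inl (hzs f hf)
      · rw [hpos, hhit]
        change φ' ≤ t' - _ - e'
        linarith
  · have hlb := hloss.resolve_left hla
    right
    set c := unitRequest b.loc t ht0
    obtain ⟨hne, hcard, hweight, hgap, hlast⟩ := hnew c hbt rfl
    have hag : x.AgreesUntil (A.run (insert c I)) t := A.agreesUntil_insert I c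
    have hpos : (A.run (insert c I)).pos c.release = x.pos t := (hag t ht0 le_rfl).symm
    rw [not_lt] at hla
    refine ⟨insert c I, a, c, hcard,
      ⟨Finset.mem_insert_of_mem h.mem_a, Finset.mem_insert_self _ _, hne a h.mem_a, hweight, hgap,
        hlast, hLab, ?_, ?_, ?_, ?_, ?_⟩⟩
    · intro f hf hfa hfc
      have hfI := (Finset.mem_insert.1 hf).resolve_left hfc
      by_cases hfb : f = b
      · rw [hfb]
        exact (hlostb hlb).congr ht0 hag
      · exact ((h.lost f hfI hfa hfb).mono hr hbt').congr ht0 hag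
    · intro s hs
      rw [← hag s (a.release_nonneg.trans hs.1) hs.2]
      exact hua s hs
    · rw [hpos]
      exact (hfar t ⟨hbt', le_rfl⟩).1
    · rw [hpos]
      change L / 2 ≤ dist (x.pos t) b.loc
      linarith [dist_triangle_left a.loc b.loc (x.pos t)]
    · intro hP
      obtain ⟨y, τ, hτ, hy, hserves, hphi⟩ := h.offline hP
      -- Every exceptional request is released after `τ`, hence not before `a`. As `a` can still be
      -- reached at `t`, none of them has expired.
      have haτ : a.release ≤ τ := by
        rcases hserves a h.mem_a with ⟨s, hs, hsτ, -⟩ | ⟨hl, -⟩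
        · exact hs.1.trans hsτ
        · exact absurd hl hloc
      have hta : t ≤ a.deadline := by linarith [dist_nonneg (x := x.pos t) (y := a.loc)]
      refine ⟨y, τ, hτ, hy, fun f hf => ?_, ?_⟩
      · rcases Finset.mem_insert.1 hf with rfl | hf
        · refine Or.inr ⟨rfl, ?_, ?_⟩
          · change τ ≤ t
            linarith [dist_nonneg (x := x.pos b.release) (y := a.loc)]
          · change t ≤ t + 2
            linarith
        · refine (hserves f hf).imp_right fun hs => ⟨hs.1, hs.2.1, ?_⟩
          change t ≤ f.release + 2
          linarith [hs.2.1]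
      · rw [hpos]
        change φ' ≤ t - τ - dist (x.pos t) a.loc
        have h1 := x.speed b.release t hr hbt'
        have h2 := dist_triangle_left (x.pos t) a.loc (x.pos b.release)
        linarith

end OnlineAlgorithm.Pursuit

/-- Playing the game to its end. -/
theorem OnlineAlgorithm.Pursuit.defeated_of_card (hgeo : IsGeodesicSpace X)
    {A : OnlineAlgorithm O} {P : Prop} {L T σ : ℝ} {e φ : ℕ → ℝ} {n : ℕ} (hL2 : L ≤ 2)
    (hσ : 0 < σ) (hL : 2 - σ < L) (hL' : 4 / 3 < L) (he0 : ∀ k, σ ≤ e k)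
    (hstep : ∀ k, ∃ w, T ≤ w ∧ e k + 2 * σ ≤ w ∧ w + e k + σ ≤ e (k + 1))
    (hφ0 : ∀ k, 0 ≤ φ k) (hφ : ∀ k, φ (k + 1) = φ k + 2 * e k) :
    ∀ (k : ℕ), e k ≤ L / 2 → (P → φ k ≤ L / 2) → ∀ (I : Finset (Request X)) (a b : Request X),
      I.card + k = n → A.Pursuit P L T (e k) (φ k) I a b → A.Defeated n T P := by
  intro k
  induction k with
  | zero =>
    rintro _ _ I a b rfl h
    exact h.defeated hgeo hL2 hL' (by linarith [he0 0])
  | succ k ih =>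
    intro hek hφk I a b hcard h
    obtain ⟨w, hTw, hw, hwe⟩ := hstep k
    have hepos : 0 < e k := hσ.trans_le (he0 k)
    rcases h.exists_next hgeo hL2 hσ hL.le hepos hek hTw hw hwe (hφ0 k) (hφ k) hφk
      (show I.card ≤ n by omega) with hd | ⟨J, a', b', hJ, h'⟩
    · exact hd
    · refine ih (by linarith) (fun hP => ?_) J a' b' (by omega) h'
      linarith [hφk hP, hφ k]

/-- The opening of the game. -/
theorem OnlineAlgorithm.defeated_of_points (hgeo : IsGeodesicSpace X)
    (hdist : ∀ p q : X, dist p q ≤ 2) (A : OnlineAlgorithm O) {P : Prop} {T σ : ℝ} {e φ : ℕ → ℝ}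
    {k : ℕ} {p q : X} (hσ : 0 < σ) (hL : 2 - σ < dist p q) (hL' : 4 / 3 < dist p q)
    (he0 : ∀ k, σ ≤ e k)
    (hstep : ∀ k, ∃ w, T ≤ w ∧ e k + 2 * σ ≤ w ∧ w + e k + σ ≤ e (k + 1))
    (hφ0 : ∀ k, 0 ≤ φ k) (hφ : ∀ k, φ (k + 1) = φ k + 2 * e k)
    (hek : e k + T ≤ dist p q / 2) (hne : e k < dist p q / 2)
    (hP : P → φ (k + 1) ≤ dist p q / 2) : A.Defeated (k + 2) T P := by
  classical
  -- the first request is released at the endpoint that is farther away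
  wlog hfar : dist p q / 2 ≤ dist ((A.run ∅).pos 2) p generalizing p q
  · rw [dist_comm p q] at *
    refine this hL hL' hek hne hP ?_
    have := dist_triangle_left p q ((A.run ∅).pos 2)
    rw [dist_comm p q] at this
    linarith
  set L := dist p q with hLdef
  have hepos : 0 < e k := hσ.trans_le (he0 k)
  -- By time 2 an offline vehicle can be at `p`, wherever the origin is.
  set a := unitRequest p 2 zero_le_two with ha
  set I : Finset (Request X) := {a} with hI
  set x := A.run I with hx
  have hag0 : (A.run ∅).AgreesUntil x 2 := by
    have := A.agreesUntil_insert ∅ a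
    rwa [insert_empty_eq] at this
  have hxfar : L / 2 ≤ dist (x.pos 2) p := by
    rw [← hag0 2 zero_le_two le_rfl]
    exact hfar
  rcases x.exists_first_hit p zero_le_two (hne.le.trans hxfar) with hnever | ⟨t, h2t, hhit, hout⟩
  · refine ⟨I, ⟨Finset.singleton_nonempty _, by simp [hI], ?_⟩, ?_, Or.inl ?_⟩
    · intro f hf g hg hfg
      rw [hI, Finset.mem_singleton] at hf hg
      exact absurd (hf.trans hg.symm) hfg
    · intro f hf
      rw [Finset.mem_singleton.1 hf]
      rfl
    · intro f hf
      rw [Finset.mem_singleton.1 hf]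
      rintro ⟨s, hs, hsa⟩
      have := hnever s hs.1
      rw [hsa] at this
      simp only [ha, unitRequest, dist_self] at this
      linarith
  have ht0 : 0 ≤ t := zero_le_two.trans h2t
  -- This gap must cover the delay `T`, and after subtracting the remaining distance `e k` it is the
  -- initial offline lead.
  have htime : L / 2 - e k ≤ t - 2 := by
    have := x.dist_sub_le zero_le_two h2t p
    linarith
  set b := unitRequest q t ht0 with hb
  have hag : x.AgreesUntil (A.run (insert b I)) t := A.agreesUntil_insert I b
  have hpos : (A.run (insert b I)).pos b.release = x.pos t := (hag t ht0 le_rfl).symm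
  have hne_ab : a ≠ b := by
    intro hab
    have : (2 : ℝ) = t := congrArg Request.release hab
    linarith
  have hmem : ∀ f ∈ insert b I, f = b ∨ f = a := by
    intro f hf
    simpa [hI] using hf
  refine OnlineAlgorithm.Pursuit.defeated_of_card hgeo (hdist p q) hσ hL hL' he0 hstep hφ0 hφ k
    hne.le (fun h => ?_) (insert b I) a b ?_ ⟨?_, ?_, hne_ab, ?_, ?_, ?_, rfl, ?_, ?_, ?_, ?_, ?_⟩
  · linarith [hP h, hφ k]
  · rw [Finset.card_insert_of_notMem (by simpa [hI] using hne_ab.symm), hI, Finset.card_singleton]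
    omega
  · exact Finset.mem_insert_of_mem (Finset.mem_singleton_self _)
  · exact Finset.mem_insert_self _ _
  · intro f hf
    rcases hmem f hf with rfl | rfl <;> rfl
  · have h2 : T ≤ t - 2 := by linarith
    intro f hf g hg hfg
    rcases hmem f hf with rfl | rfl <;> rcases hmem g hg with rfl | rfl
    · exact absurd rfl hfg
    · exact h2.trans (le_abs_self _)
    · rw [abs_sub_comm]
      exact h2.trans (le_abs_self _)
    · exact absurd rfl hfg
  · intro f hf
    rcases hmem f hf with rfl | rfl
    exacts [le_rfl, h2t]
  · intro f hf hfa hfb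
    exact ((hmem f hf).elim hfb hfa).elim
  · intro s hs
    rw [← hag s (zero_le_two.trans hs.1) hs.2]
    exact dist_pos.1 (hepos.trans_le (hout s hs))
  · rw [hpos]
    exact hhit.ge
  · rw [hpos]
    change L / 2 ≤ dist (x.pos t) q
    linarith [dist_triangle_left p q (x.pos t)]
  · intro h
    obtain ⟨y, -, hy, hstay⟩ := (Itinerary.stay O).exists_extension hgeo le_rfl dist_nonneg p
      (le_refl (dist ((Itinerary.stay O).pos 0) p))
    have hy2 : y.pos 2 = p := by
      have h1 : 0 + dist ((Itinerary.stay O).pos 0) p ≤ 2 := by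
        rw [zero_add]
        exact hdist _ _
      rw [hstay 2 h1]
      refine dist_eq_zero.1 ?_
      rw [hy _ ⟨by simp, le_rfl⟩]
      ring
    refine ⟨y, 2, zero_le_two, hy2, fun f hf => ?_, ?_⟩
    · rcases hmem f hf with rfl | rfl
      · refine Or.inr ⟨rfl, h2t, ?_⟩
        change t ≤ t + 2
        linarith
      · refine Or.inl ⟨2, ⟨le_rfl, ?_⟩, le_rfl, hy2⟩
        change (2 : ℝ) ≤ 2 + 2
        norm_num
    · rw [hpos]
      change φ k ≤ t - 2 - dist (x.pos t) p
      rw [hhit]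
      linarith [hP h, hφ k]

end

end OPTiWinD

namespace OPTiWinD

section

variable {X : Type*} [MetricSpace X] {O : X}

theorem OnlineAlgorithm.Defeated.performance_le {A : OnlineAlgorithm O} {n : ℕ} {T : ℝ} {P : Prop}
    (h : A.Defeated n T P) : A.performance n T ≤ 1 / (n : ℝ) := by
  obtain ⟨I, hI, hw, h⟩ := h
  refine (A.performance_le hI).trans ?_
  rcases h with h | ⟨hcard, h, -⟩
  · rw [Itinerary.performance_eq_zero h]
    positivity
  · rw [← hcard]
    exact Itinerary.performance_le_inv_card hw h

theorem OnlineAlgorithm.Defeated.competitiveRatio_le {A : OnlineAlgorithm O} {n : ℕ} {T : ℝ}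
    {P : Prop} (hP : P) (h : A.Defeated n T P) : A.competitiveRatio n T ≤ 1 / (n : ℝ) := by
  obtain ⟨I, hI, hw, h⟩ := h
  refine (A.competitiveRatio_le hI).trans ?_
  rcases h with h | ⟨hcard, h, hy⟩
  · rw [Itinerary.performance_eq_zero h, zero_div]
    positivity
  · obtain ⟨y, hy⟩ := hy hP
    have h1 : offlinePerformance O I = 1 :=
      le_antisymm (offlinePerformance_le_one O I)
        ((y.performance_eq_one hI.1 hy).ge.trans (y.performance_le_offline I))
    rw [h1, div_one, ← hcard]
    exact Itinerary.performance_le_inv_card hw h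

theorem dist_le_two (hdiam : Metric.diam (Set.univ : Set X) = 2) (p q : X) : dist p q ≤ 2 := by
  have hb : Bornology.IsBounded (Set.univ : Set X) := by
    -- `Metric.diam` of an unbounded set is 0, so the value 2 forces boundedness.
    by_contra h
    rw [Metric.diam_eq_zero_of_unbounded h] at hdiam
    norm_num at hdiam
  exact hdiam ▸ Metric.dist_le_diam_of_mem hb (Set.mem_univ p) (Set.mem_univ q)

theorem exists_dist_gt (hdiam : Metric.diam (Set.univ : Set X) = 2) {σ : ℝ} (hσ : 0 < σ)
    (hσ' : σ ≤ 2) : ∃ p q : X, 2 - σ < dist p q := by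
  by_contra! h
  have := Metric.diam_le_of_forall_dist_le (s := (Set.univ : Set X)) (by linarith)
    fun p _ q _ => h p q
  linarith

/-! ### Choice of the margins and the thresholds for the delay -/

/-- The distance from the older pending request at which the adversary releases a request at the
other endpoint if `k` more requests may follow. -/
noncomputable def margin (T σ : ℝ) : ℕ → ℝ
  | 0 => σ
  | k + 1 => 2 ^ k * (T + 9 * σ) - 4 * σ

theorem le_margin {T σ : ℝ} (hT : 0 ≤ T) (hσ : 0 < σ) (k : ℕ) : T + 5 * σ ≤ margin T σ (k + 1) := by
  have h := mul_le_mul_of_nonneg_right (one_le_pow₀ (one_le_two (α := ℝ)) (n := k))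
    (show 0 ≤ T + 9 * σ by linarith)
  rw [margin]
  linarith

theorem margin_pos {T σ : ℝ} (hT : 0 ≤ T) (hσ : 0 < σ) : ∀ k, σ ≤ margin T σ k
  | 0 => le_rfl
  | k + 1 => by linarith [le_margin hT hσ k]

theorem exists_margin_step {T σ : ℝ} (hT : 0 ≤ T) (hσ : 0 < σ) :
    ∀ k, ∃ w, T ≤ w ∧ margin T σ k + 2 * σ ≤ w ∧ w + margin T σ k + σ ≤ margin T σ (k + 1)
  | 0 => ⟨T + 3 * σ, by linarith, by simp only [margin]; linarith, by
      simp only [margin, pow_zero]; linarith⟩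
  | k + 1 => ⟨margin T σ (k + 1) + 2 * σ, by linarith [le_margin hT hσ k], le_rfl, by
      simp only [margin, pow_succ]; linarith⟩

/-- This sum is the total offline lead that the game may consume, including the opening. -/
theorem two_mul_sum_margin (T σ : ℝ) (k : ℕ) :
    2 * ∑ i ∈ Finset.range (k + 1), margin T σ i =
      (2 ^ (k + 1) - 2) * (T + 9 * σ) + 2 * σ - 8 * k * σ := by
  induction k with
  | zero => simp [margin]
  | succ k ih =>
    rw [Finset.sum_range_succ, mul_add, ih, margin]
    push_cast
    ring

/-- The proposition `P` is a switch: `False` drops the offline condition and is used for the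
performance, `True` keeps it and is used for the competitive ratio. -/
theorem OnlineAlgorithm.defeated (hgeo : IsGeodesicSpace X)
    (hdiam : Metric.diam (Set.univ : Set X) = 2) (A : OnlineAlgorithm O) {P : Prop} {T σ : ℝ}
    {k : ℕ} (hT : 0 ≤ T) (hσ : 0 < σ) (hσ' : σ ≤ 1 / 9) (hk : margin T σ k + T ≤ 1 - σ / 2)
    (hP : P → (2 ^ (k + 1) - 2) * (T + 9 * σ) + 2 * σ - 8 * k * σ ≤ 1 - σ / 2) :
    A.Defeated (k + 2) T P := by
  obtain ⟨p, q, hpq⟩ := exists_dist_gt hdiam hσ (by linarith)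
  refine A.defeated_of_points hgeo (dist_le_two hdiam) (σ := σ) (e := margin T σ)
    (φ := fun k => 2 * ∑ i ∈ Finset.range k, margin T σ i) (p := p) (q := q) hσ hpq (by linarith)
    (margin_pos hT hσ) (exists_margin_step hT hσ) (fun k => ?_) (fun k => ?_) (by linarith)
    (by linarith) fun h => ?_
  · exact mul_nonneg zero_le_two
      (Finset.sum_nonneg fun i _ => hσ.le.trans (margin_pos hT hσ i))
  · rw [Finset.sum_range_succ, mul_add]
  · rw [two_mul_sum_margin]
    linarith [hP h]

theorem OnlineAlgorithm.performance_le_inv (hgeo : IsGeodesicSpace X)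
    (hdiam : Metric.diam (Set.univ : Set X) = 2) (A : OnlineAlgorithm O) {n : ℕ} (hn : 1 ≤ n)
    {T : ℝ} (hT : 0 ≤ T) (hTn : T < 1 / ((2 : ℝ) ^ ((n : ℤ) - 3) + 1)) :
    A.performance n T ≤ 1 / (n : ℝ) := by
  obtain rfl | rfl | ⟨k, rfl⟩ : n = 1 ∨ n = 2 ∨ ∃ k, n = k + 1 + 2 := by
    rcases n with _ | _ | _ | k
    · omega
    · exact Or.inl rfl
    · exact Or.inr (Or.inl rfl)
    · exact Or.inr (Or.inr ⟨k, rfl⟩)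
  · obtain ⟨⟨I, hI⟩⟩ := instances_nonempty O le_rfl T
    simpa using (A.performance_le hI).trans (Itinerary.performance_le_one _ _)
  · norm_num at hTn
    refine (A.defeated (P := False) hgeo hdiam (k := 0) hT (σ := 1 / 9) (by norm_num) le_rfl ?_
      False.elim).performance_le
    rw [margin]
    linarith
  · have hexp : (((k + 1 + 2 : ℕ) : ℤ) - 3) = (k : ℤ) := by push_cast; ring
    rw [hexp, zpow_natCast] at hTn
    have hpow : (1 : ℝ) ≤ 2 ^ k := one_le_pow₀ one_le_two
    rw [lt_div_iff₀ (by positivity)] at hTn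
    -- This `σ` solves `2 ^ k * (T + 9 * σ) + T = 1`; the term `-4 * σ` in `margin` leaves the
    -- required slack.
    set σ := (1 - T * (2 ^ k + 1)) / (9 * 2 ^ k) with hσdef
    have hσ : 0 < σ := div_pos (by linarith) (by positivity)
    have hσeq : 9 * 2 ^ k * σ = 1 - T * (2 ^ k + 1) := by
      rw [hσdef]
      field_simp
    have h1 := mul_le_mul_of_nonneg_right hpow hσ.le
    have h2 : 0 ≤ T * (2 ^ k + 1) := by positivity
    refine (A.defeated (P := False) hgeo hdiam (k := k + 1) hT hσ (by linarith) ?_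
      False.elim).performance_le
    rw [margin]
    linarith

theorem OnlineAlgorithm.competitiveRatio_le_inv (hgeo : IsGeodesicSpace X)
    (hdiam : Metric.diam (Set.univ : Set X) = 2) (A : OnlineAlgorithm O) {n : ℕ} (hn : 3 ≤ n)
    {T : ℝ} (hT : 0 ≤ T) (hTn : T < 1 / ((2 : ℝ) ^ ((n : ℤ) - 1) - 2)) :
    A.competitiveRatio n T ≤ 1 / (n : ℝ) := by
  obtain ⟨k, rfl⟩ : ∃ k, n = k + 1 + 2 := ⟨n - 3, by omega⟩
  have hexp : (((k + 1 + 2 : ℕ) : ℤ) - 1) = ((k + 2 : ℕ) : ℤ) := by push_cast; ring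
  rw [hexp, zpow_natCast] at hTn
  have hpow : (1 : ℝ) ≤ 2 ^ k := one_le_pow₀ one_le_two
  have hpow2 : (2 : ℝ) ^ (k + 2) = 4 * 2 ^ k := by ring
  rw [hpow2, lt_div_iff₀ (by linarith)] at hTn
  -- This `σ` solves `(4 * 2 ^ k - 2) * (T + 9 * σ) = 1`, the leading part of the offline condition.
  set σ := (1 - T * (4 * 2 ^ k - 2)) / (9 * (4 * 2 ^ k - 2)) with hσdef
  have hden : (0 : ℝ) < 4 * 2 ^ k - 2 := by linarith
  have hσ : 0 < σ := div_pos (by linarith) (by linarith)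
  have hσeq : 9 * (4 * 2 ^ k - 2) * σ = 1 - T * (4 * 2 ^ k - 2) := by
    rw [hσdef]
    field_simp
  have h1 := mul_le_mul_of_nonneg_right hpow hσ.le
  have h2 := mul_le_mul_of_nonneg_right hpow hT
  have h3 : 0 ≤ (k : ℝ) * σ := by positivity
  refine (A.defeated (P := True) hgeo hdiam (k := k + 1) hT hσ (by linarith) ?_
    fun _ => ?_).competitiveRatio_le trivial
  · rw [margin]
    linarith
  · rw [show k + 1 + 1 = k + 2 from rfl, hpow2]
    push_cast
    linarith

/-- For `n = 2` the denominator `2 ^ (n - 1) - 2` vanishes, so this case is played separately; from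
`n = 3` on, zero delay is a case of small delay. -/
theorem OnlineAlgorithm.competitiveRatio_zero_le_inv (hgeo : IsGeodesicSpace X)
    (hdiam : Metric.diam (Set.univ : Set X) = 2) (A : OnlineAlgorithm O) {n : ℕ} (hn : 1 ≤ n) :
    A.competitiveRatio n 0 ≤ 1 / (n : ℝ) := by
  obtain rfl | rfl | h3 : n = 1 ∨ n = 2 ∨ 3 ≤ n := by omega
  · obtain ⟨⟨I, hI⟩⟩ := instances_nonempty O le_rfl (0 : ℝ)
    simpa using (A.competitiveRatio_le hI).trans (Itinerary.ratio_le_one _ _)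
  · refine (A.defeated (P := True) hgeo hdiam (k := 0) le_rfl (σ := 1 / 9) (by norm_num) le_rfl ?_
      fun _ => ?_).competitiveRatio_le trivial
    · rw [margin]
      norm_num
    · norm_num
  · refine A.competitiveRatio_le_inv hgeo hdiam h3 le_rfl (one_div_pos.2 ?_)
    have : (2 : ℝ) ^ (2 : ℤ) ≤ 2 ^ ((n : ℤ) - 1) :=
      zpow_le_zpow_right₀ one_le_two (by omega)
    norm_num at this
    linarith

end

end OPTiWinD

theorem mainTheorem12 {X : Type*} [MetricSpace X] (hgeo : OPTiWinD.IsGeodesicSpace X)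
    (hdiam : Metric.diam (Set.univ : Set X) = 2) (O : X) (n : ℕ) (hn : 1 ≤ n) :
    -- greedy algorithms exist
    (∃ A : OPTiWinD.OnlineAlgorithm O, A.IsGreedy) ∧
    -- zero delay
    ((∀ A : OPTiWinD.OnlineAlgorithm O, A.IsGreedy → A.IsOptimal n 0) ∧
      OPTiWinD.optimalCompetitiveRatio O n 0 = 1 / (n : ℝ)) ∧
    -- small delay, performance
    (∀ T : ℝ, 0 ≤ T → T < 1 / ((2 : ℝ) ^ ((n : ℤ) - 3) + 1) →
      OPTiWinD.optimalPerformance O n T = 1 / (n : ℝ)) ∧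
    -- small delay, competitive ratio
    (3 ≤ n → ∀ T : ℝ, 0 ≤ T → T < 1 / ((2 : ℝ) ^ ((n : ℤ) - 1) - 2) →
      (∀ A : OPTiWinD.OnlineAlgorithm O, A.IsGreedy → A.IsOptimal n T) ∧
        OPTiWinD.optimalCompetitiveRatio O n T = 1 / (n : ℝ)) := by
  have hdist := OPTiWinD.dist_le_two hdiam
  exact ⟨OPTiWinD.exists_isGreedy hgeo O,
    OPTiWinD.optimalCompetitiveRatio_eq hgeo hdist hn fun A =>
      A.competitiveRatio_zero_le_inv hgeo hdiam hn,
    fun T hT hTn => OPTiWinD.optimalPerformance_eq hgeo hdist hn fun A =>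
      A.performance_le_inv hgeo hdiam hn hT hTn,
    fun h3 T hT hTn => OPTiWinD.optimalCompetitiveRatio_eq hgeo hdist hn fun A =>
      A.competitiveRatio_le_inv hgeo hdiam h3 hT hTn⟩
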